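/- All vector spaces are real. Let $L$ be a compact Hausdorff space that is not scattered (a space is scattered if each of its nonempty subsets has an isolated point in the relative topology). Conventions. Let $K$ be a nonempty compact convex subset of a Hausdorff locally convex space. For a Banach space $E$, $A(K,E)$ is the space of continuous affine maps $K\to E$ with the supremum norm, and $A(K)=A(K,\mathbb R)$. A regular Borel probability measure on $K$ is maximal if it is maximal in the order $\mu\prec\nu$ iff $\int f\,d\mu\le\int f\,d\nu$ for all continuous convex $f\colon K\to\mathbb R$; it represents $t\in K$ if $\int a\,d\mu=a(t)$ for all $a\in A(K)$; $K$ is a simplex if every $t\in K$ is represented by exactly one maximal probability measure. A vector measure of bounded variation is boundary if its variation is zero or, after normalization, a maximal probability measure. For Banach spaces $E,F$, a representing measure of an operator $T\colon A(K,E)\to F$ is a finitely additive map $G\colon\operatorname{Borel}(K)\to L(E,F^{**})$ such that: for each $y^*\in F^*$ the formula $G_{y^*}(B)x=(G(B)x)(y^*)$ defines a countably additive regular boundary $E^*$-valued Borel measure of bounded variation; for each $f\in A(K,E)$ the map $y^*\mapsto\int f\,dG_{y^*}$ is weak$^*$ continuous on $F^*$ and $\int f\,dG_{y^*}=y^*(Tf)$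 for all $y^*$; and $\|T\|=\|G\|(K)<\infty$, where $\|G\|(B)=\sup\|\sum_{i=1}^n G(B_i)x_i\|$ over finite families of pairwise disjoint Borel $B_i\subset B$ and $x_i$ in the unit ball of $E$. A control measure of $G$ is a finite positive regular Borel measure $\lambda$ on $K$ with $\|G\|(B)\to0$ as $\lambda(B)\to0$, $B$ Borel. A measure is discrete if it equals $\sum_n a_n\varepsilon_{t_n}$ for a sequence of points $t_n$ and a summable sequence $a_n\ge0$, where $\varepsilon_t$ is the Dirac measure at $t$. Then there exists a simplex $K$ such that: (a) the set $\operatorname{ext}K$ of extreme points of $K$, with the relative topology, is scattered; (b) there is a bounded linear functional $T\colon A(K)\to\mathbb R$ that has a representing measure, and no representing measure of $T$ has a discrete control measure; (c) for every Banach space $E$, the space $C(L,E)$ of continuous maps $L\to E$ with the supremum norm is $1$-complemented in $A(K,E)$, i.e. there are a linear isometric embedding of $C(L,E)$ into $A(K,E)$ and a linear projection of $A(K,E)$ onto its image of norm at most $1$. -/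

import Mathlib

universe u v

set_option maxSynthPendingDepth 3

noncomputable section

open MeasureTheory Topology
open scoped ENNReal NNReal

namespace ChoquetTheory

/-- A set `A` in a topological space is scattered (in its subspace topology): every nonempty
subset of `A` has a (relatively) isolated point. -/
def IsScattered {X : Type*} [TopologicalSpace X] (A : Set X) : Prop :=
  ∀ S : Set X, S ⊆ A → S.Nonempty → ∃ x ∈ S, ∃ U : Set X, IsOpen U ∧ U ∩ S = {x}

/-- `X` is (isometric to) a 1-complemented subspace of `Y`: there are a linear isometric embedding
of `X` into `Y` and a linear projection of `Y`, of norm at most one, onto the image of `X`. -/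
def IsOneComplementedIn (X Y : Type*) [NormedAddCommGroup X] [NormedSpace ℝ X]
    [NormedAddCommGroup Y] [NormedSpace ℝ Y] : Prop :=
  ∃ (i : X →ₗᵢ[ℝ] Y) (P : Y →L[ℝ] Y),
    (∀ y, P (P y) = P y) ∧ Set.range P = Set.range i ∧ ‖P‖ ≤ 1

section Functions

variable {V : Type*} [AddCommGroup V] [Module ℝ V]

/-- Affine maps on a convex set `K`: `f (a x + b y) = a f x + b f y` for convex combinations. -/
def IsAffineOn {E : Type*} [AddCommGroup E] [Module ℝ E] (K : Set V) (f : K → E) : Prop :=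
  ∀ (x y z : K) (a b : ℝ), 0 ≤ a → 0 ≤ b → a + b = 1 →
    (z : V) = a • (x : V) + b • (y : V) → f z = a • f x + b • f y

/-- Convex real functions on a convex set `K`. -/
def IsConvexOn (K : Set V) (f : K → ℝ) : Prop :=
  ∀ (x y z : K) (a b : ℝ), 0 ≤ a → 0 ≤ b → a + b = 1 →
    (z : V) = a • (x : V) + b • (y : V) → f z ≤ a * f x + b * f y

variable [TopologicalSpace V]

/-- `A(K, E)`: the continuous affine maps from `K` to `E`, as a subspace of `C(K, E)`.
For compact `K` it carries the supremum norm inherited from `C(K, E)`. -/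
def A (K : Set V) (E : Type*) [NormedAddCommGroup E] [NormedSpace ℝ E] :
    Submodule ℝ C(K, E) where
  carrier := {f | IsAffineOn K f}
  zero_mem' := by
    intro x y z a b _ _ _ _
    simp
  add_mem' := by
    intro f g hf hg x y z a b ha hb hab hz
    simp only [ContinuousMap.add_apply, hf x y z a b ha hb hab hz, hg x y z a b ha hb hab hz,
      smul_add]
    abel
  smul_mem' := by
    intro c f hf x y z a b ha hb hab hz
    simp only [ContinuousMap.smul_apply, hf x y z a b ha hb hab hz, smul_add, smul_comm c]

end Functions

section Measures

variable {V : Type*} [AddCommGroup V] [Module ℝ V] [TopologicalSpace V]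
  [MeasurableSpace V] [BorelSpace V] {K : Set V}

/-- `μ ∈ M¹(K)`: a regular Borel probability measure on `K`. -/
def IsProb (μ : Measure K) : Prop :=
  IsProbabilityMeasure μ ∧ μ.Regular

/-- `μ ∈ M⁺(K)`: a finite positive regular Borel measure on `K`. -/
def IsPosMeasure (μ : Measure K) : Prop :=
  IsFiniteMeasure μ ∧ μ.Regular

/-- The Choquet dilation order `μ ≺ ν`: `μ(f) ≤ ν(f)` for every convex continuous `f` on `K`. -/
def DilationLE (μ ν : Measure K) : Prop :=
  ∀ f : C(K, ℝ), IsConvexOn K f → ∫ t, f t ∂μ ≤ ∫ t, f t ∂ν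

/-- A probability measure in `M¹(K)` that is maximal in the dilation order. -/
def IsMaximalProb (μ : Measure K) : Prop :=
  IsProb μ ∧ ∀ ν : Measure K, IsProb ν → DilationLE μ ν → DilationLE ν μ

/-- `t` is the barycenter of `μ`, that is, `μ` represents `t`. -/
def Represents (μ : Measure K) (t : K) : Prop :=
  ∀ a ∈ A K ℝ, ∫ s, a s ∂μ = a t

/-- Every point of `K` is represented by exactly one maximal probability measure. -/
def IsSimplex (K : Set V) : Prop :=
  ∀ t : K, ∃! μ : Measure K, IsMaximalProb μ ∧ Represents μ t

/-- A finite positive measure is boundary if it is zero or its normalization is maximal. -/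
def IsBoundary (μ : Measure K) : Prop :=
  μ = 0 ∨ IsMaximalProb ((μ Set.univ)⁻¹ • μ)

/-- `λ = ∑ aₙ ε_{tₙ}` for a sequence of points `tₙ` and a summable sequence `aₙ ≥ 0`
(zero weights and repeated points are allowed, so finite sums of Dirac measures are included). -/
def IsDiscrete (m : Measure K) : Prop :=
  ∃ (t : ℕ → K) (a : ℕ → ℝ≥0), Summable a ∧
    m = Measure.sum fun n => (a n : ℝ≥0∞) • Measure.dirac (t n)

variable {E F : Type*} [NormedAddCommGroup E] [NormedSpace ℝ E]
  [NormedAddCommGroup F] [NormedSpace ℝ F]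

/-- `μ ∈ M_bnd(K, E*)`: a countably additive `E*`-valued Borel measure of bounded variation
whose variation `|μ|` is regular and boundary. -/
def IsBoundaryVectorMeasure (μ : VectorMeasure K (StrongDual ℝ E)) : Prop :=
  IsPosMeasure μ.variation ∧ IsBoundary μ.variation

/-- The integral `∫ f dμ` of `f : K → E` against an `E*`-valued measure `μ`; on simple functions
it is `∑ μ(Aⱼ)(xⱼ)`. -/
def dualIntegral (f : K → E) (μ : VectorMeasure K (StrongDual ℝ E)) : ℝ :=
  ∫ᵛ t, f t ∂[ContinuousLinearMap.apply ℝ ℝ; μ]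

/-- The semivariation `‖G‖(B)` of a set function on Borel sets with values in `L(E, F**)`. -/
def semivariation (G : Set K → (E →L[ℝ] StrongDual ℝ (StrongDual ℝ F))) (B : Set K) : ℝ≥0∞ :=
  ⨆ (n : ℕ) (D : Fin n → Set K) (x : Fin n → E)
    (_ : ∀ i, MeasurableSet (D i) ∧ D i ⊆ B) (_ : ∀ i j, i ≠ j → Disjoint (D i) (D j))
    (_ : ∀ i, ‖x i‖ ≤ 1), ‖∑ i, G (D i) (x i)‖ₑ

/-- `G` is the representing measure of the operator `T : A(K, E) → F`. Only the values of `G` on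
Borel sets matter. The family `Gy` is the family of measures `G_{y*}(B)x = (G(B)x)(y*)`. -/
def IsRepresentingMeasure [CompactSpace K] (T : A K E →L[ℝ] F)
    (G : Set K → (E →L[ℝ] StrongDual ℝ (StrongDual ℝ F))) : Prop :=
  (∀ B C : Set K, MeasurableSet B → MeasurableSet C → Disjoint B C →
    G (B ∪ C) = G B + G C) ∧
  (∃ Gy : StrongDual ℝ F → VectorMeasure K (StrongDual ℝ E),
    (∀ (y : StrongDual ℝ F) (B : Set K), MeasurableSet B → ∀ x : E, Gy y B x = G B x y) ∧
    (∀ y, IsBoundaryVectorMeasure (Gy y)) ∧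
    (∀ f : A K E, Continuous fun y : WeakDual ℝ F =>
      dualIntegral (f : C(K, E)) (Gy (WeakDual.toStrongDual y))) ∧
    (∀ (y : StrongDual ℝ F) (f : A K E), y (T f) = dualIntegral (f : C(K, E)) (Gy y))) ∧
  semivariation G Set.univ ≠ ∞ ∧
  ‖T‖ₑ = semivariation G Set.univ

/-- `m ∈ M⁺(K)` is a control measure of `G`: `‖G‖(B) → 0` as `m(B) → 0`, `B` Borel. -/
def IsControlMeasure (m : Measure K)
    (G : Set K → (E →L[ℝ] StrongDual ℝ (StrongDual ℝ F))) : Prop :=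
  IsPosMeasure m ∧ ∀ ε : ℝ≥0∞, 0 < ε → ∃ δ : ℝ≥0∞, 0 < δ ∧
    ∀ B : Set K, MeasurableSet B → m B < δ → semivariation G B < ε

end Measures

end ChoquetTheory

end

/-! `K` is a porcupine simplex: the probability measures on `L`, with a segment ("hair") from `(δ_l,
-1_l)` to `(δ_l, 1_l)` glued through each Dirac measure `δ_l`. The first coordinate is a state of
`C(L, ℝ)`, the second records a signed displacement along each hair, bounded by the mass at its
root.

The only candidate for a maximal measure of `s` is the state measure carried to the body `l ↦ (δ_l,
0)`, with each atom split between the two tips of its hair. It dominates every measure representing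
`s` (`dilationLE_boundaryMeasure`), so it is the unique maximal one. The argument uses that a
continuous function varies little along all but finitely many hairs.

(a) Multiplicativity of the state at an extreme point forces it to be a tip, and a hair coordinate
isolates each tip. (b) A nonempty perfect subset of `L` carries a diffuse state `t`
(`exists_diffuse`). Its maximal measure is atomless, living on the body. A representing measure of
evaluation at `t` must reproduce this measure by the norm condition, whereas a discrete control
measure would concentrate it on a countable set. (c) Integration against state measures embeds `C(L,
E)`, and restriction to the body is a contractive left inverse. -/

set_option linter.unusedSectionVars false

noncomputable section

open MeasureTheory Topology
open scoped ENNReal NNReal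

namespace ChoquetTheory

/-! ### Regular measures on a compact space and positive functionals -/

section RieszCompact

variable {X : Type*} [TopologicalSpace X] [CompactSpace X] [T2Space X] [MeasurableSpace X]
  [BorelSpace X]

/-- The Riesz representation theorem for positive functionals on `C(X, ℝ)`, `X` compact. -/
lemma exists_regular_integral_eq (Λ : C(X, ℝ) →ₗ[ℝ] ℝ) (hΛ : ∀ f, 0 ≤ f → 0 ≤ Λ f) :
    ∃ μ : Measure X, IsFiniteMeasure μ ∧ μ.Regular ∧ ∀ f : C(X, ℝ), ∫ x, f x ∂μ = Λ f := by
  let Λ' : CompactlySupportedContinuousMap X ℝ →ₚ[ℝ] ℝ := PositiveLinearMap.mk₀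
    { toFun := fun f => Λ (f : C(X, ℝ))
      map_add' := fun f g => Λ.map_add (f : C(X, ℝ)) (g : C(X, ℝ))
      map_smul' := fun c f => Λ.map_smul c (f : C(X, ℝ)) }
    (fun f hf => hΛ _ fun x => hf x)
  refine ⟨RealRMK.rieszMeasure Λ', inferInstance, inferInstance, fun f => ?_⟩
  exact RealRMK.integral_rieszMeasure Λ' ⟨f, HasCompactSupport.of_compactSpace f⟩

lemma integrable_continuousMap {E : Type*} [NormedAddCommGroup E] (μ : Measure X)
    [IsFiniteMeasure μ] (f : C(X, E)) : Integrable f μ :=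
  f.continuous.integrable_of_hasCompactSupport (HasCompactSupport.of_compactSpace f)

lemma norm_integral_le_norm {E : Type*} [NormedAddCommGroup E] [NormedSpace ℝ E] (μ : Measure X)
    [IsProbabilityMeasure μ] (f : C(X, E)) : ‖∫ x, f x ∂μ‖ ≤ ‖f‖ := by
  simpa using norm_integral_le_of_norm_le_const (μ := μ) (.of_forall fun x => f.norm_coe_le_norm x)

lemma continuous_integral_continuousMap (μ : Measure X) [IsProbabilityMeasure μ] :
    Continuous fun f : C(X, ℝ) => ∫ x, f x ∂μ := by
  refine (LipschitzWith.of_dist_le_mul (K := 1) fun f g => ?_).continuous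
  rw [dist_eq_norm, dist_eq_norm, ← integral_sub (integrable_continuousMap μ f)
    (integrable_continuousMap μ g)]
  simpa using norm_integral_le_norm μ (f - g)

lemma Measure.Regular.ext_of_integral_continuousMap {μ ν : Measure X} [IsFiniteMeasure μ]
    [IsFiniteMeasure ν] (hμ : μ.Regular) (hν : ν.Regular)
    (h : ∀ f : C(X, ℝ), ∫ x, f x ∂μ = ∫ x, f x ∂ν) : μ = ν :=
  Measure.ext_of_integral_eq_on_compactlySupported fun f => h f

/-- Point masses of a regular measure are approximated by integrals of continuous functions. -/
lemma exists_integral_lt_measureReal_singleton_add (μ : Measure X) [IsFiniteMeasure μ]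
    [μ.Regular] (x : X) {ε : ℝ} (hε : 0 < ε) :
    ∃ g : C(X, ℝ), 0 ≤ g ∧ g x = 1 ∧ ∫ y, g y ∂μ < μ.real {x} + ε := by
  have h1 : μ {x} < ENNReal.ofReal (μ.real {x} + ε) := by
    rw [ENNReal.lt_ofReal_iff_toReal_lt (measure_ne_top _ _)]
    exact lt_add_of_pos_right _ hε
  obtain ⟨U, hxU, hU, hμU⟩ := Set.exists_isOpen_lt_of_lt {x} _ h1
  obtain ⟨g, hg0, hg1, hg⟩ := exists_continuous_zero_one_of_isClosed (s := Uᶜ) (t := {x})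
    hU.isClosed_compl isClosed_singleton (by simpa using hxU)
  refine ⟨g, fun y => (hg y).1, by simpa using hg1 rfl, ?_⟩
  calc ∫ y, g y ∂μ ≤ ∫ y, U.indicator 1 y ∂μ := by
        refine integral_mono (integrable_continuousMap μ g)
          ((integrable_const (1 : ℝ)).indicator hU.measurableSet) fun y => ?_
        by_cases hy : y ∈ U
        · simpa [hy] using (hg y).2
        · simpa [hy] using (hg0 (show y ∈ Uᶜ from hy)).le
    _ = μ.real U := integral_indicator_one hU.measurableSet
    _ < _ := by
      rw [measureReal_def]
      exact (ENNReal.lt_ofReal_iff_toReal_lt (measure_ne_top _ _)).1 hμU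

lemma measure_singleton_eq_zero_of_integral_le (μ : Measure X) [IsFiniteMeasure μ] (x : X)
    (h : ∀ ε : ℝ, 0 < ε → ∃ g : C(X, ℝ), 0 ≤ g ∧ g x = 1 ∧ ∫ y, g y ∂μ ≤ ε) : μ {x} = 0 := by
  have : μ.real {x} ≤ 0 := by
    refine le_of_forall_pos_le_add fun ε hε => ?_
    obtain ⟨g, hg0, hgx, hg⟩ := h ε hε
    rw [zero_add]
    refine le_trans ?_ hg
    rw [← integral_indicator_one (measurableSet_singleton x)]
    refine integral_mono ((integrable_const (1 : ℝ)).indicator (measurableSet_singleton x))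
      (integrable_continuousMap μ g) fun y => ?_
    by_cases hy : y = x
    · simp [hy, hgx]
    · simpa [hy] using hg0 y
  exact (measureReal_eq_zero_iff).1 (le_antisymm this measureReal_nonneg)

end RieszCompact

/-! ### Convex functions and uniqueness of maximal measures -/

section ConvexFunctions

variable {V : Type*} [AddCommGroup V] [Module ℝ V] {K : Set V}

lemma IsAffineOn.isConvexOn {f : K → ℝ} (hf : IsAffineOn K f) : IsConvexOn K f :=
  fun x y z a b ha hb hab hz => (hf x y z a b ha hb hab hz).le

lemma IsConvexOn.add {f g : K → ℝ} (hf : IsConvexOn K f) (hg : IsConvexOn K g) :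
    IsConvexOn K (f + g) := fun x y z a b ha hb hab hz => by
  have := hf x y z a b ha hb hab hz
  have := hg x y z a b ha hb hab hz
  simp only [Pi.add_apply]
  linarith

lemma IsConvexOn.sup {f g : K → ℝ} (hf : IsConvexOn K f) (hg : IsConvexOn K g) :
    IsConvexOn K (f ⊔ g) := fun x y z a b ha hb hab hz => by
  simp only [Pi.sup_apply]
  refine max_le ((hf x y z a b ha hb hab hz).trans ?_) ((hg x y z a b ha hb hab hz).trans ?_) <;>
  gcongr <;> simp

variable [TopologicalSpace V] [IsTopologicalAddGroup V] [ContinuousSMul ℝ V]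
  [LocallyConvexSpace ℝ V] [T2Space V] [CompactSpace K]

lemma isAffineOn_dual (l : V →L[ℝ] ℝ) (c : ℝ) : IsAffineOn K fun s : K => l s + c := by
  intro x y z a b _ _ hab hz
  simp only [hz, map_add, map_smul, smul_eq_mul]
  linear_combination -c * hab

/-- A continuous convex function has affine minorants with any prescribed smaller value at a given
point. -/
lemma IsConvexOn.exists_affine_le {f : C(K, ℝ)} (hK : Convex ℝ K) (hf : IsConvexOn K f) (x : K)
    {r : ℝ} (hr : r < f x) :
    ∃ (l : V →L[ℝ] ℝ) (c : ℝ), (∀ z : K, l z + c ≤ f z) ∧ l x + c = r := by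
  classical
  let F : V → ℝ := fun v => if h : v ∈ K then f ⟨v, h⟩ else 0
  have hF : ∀ z : K, F z = f z := fun z => by simp [F]
  have hFc : ContinuousOn F K := by
    rw [continuousOn_iff_continuous_domRestrict]
    convert f.continuous using 1
    ext z
    exact hF z
  have hFconv : ConvexOn ℝ K F := by
    refine ⟨hK, fun x hx y hy a b ha hb hab => ?_⟩
    have := hf ⟨x, hx⟩ ⟨y, hy⟩ ⟨_, hK hx hy ha hb hab⟩ a b ha hb hab rfl
    rw [← hF, ← hF, ← hF] at this
    simpa using this
  obtain ⟨l, c, h1, h2⟩ := ConvexOn.exists_affine_le_of_lt (𝕜 := ℝ) x.2 (by rwa [hF])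
    (isCompact_iff_compactSpace.2 ‹_›).isClosed hFc.lowerSemicontinuousOn hFconv
  refine ⟨l, c, fun z => ?_, by simpa using h2⟩
  simpa [hF] using h1 z

/-- Lattice form of Stone–Weierstrass. Differences of convex functions form a lattice because `min
(g₁ - h₁) (g₂ - h₂) = (g₁ + g₂) - max (g₁ + h₂) (g₂ + h₁)`, and dually for the maximum; continuous
linear functionals give interpolation at two points. -/
lemma dense_sub_isConvexOn :
    closure {f : C(K, ℝ) | ∃ g h : C(K, ℝ), IsConvexOn K g ∧ IsConvexOn K h ∧ f = g - h} = ⊤ := by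
  have haff : ∀ (l : V →L[ℝ] ℝ) (c : ℝ), ∃ g : C(K, ℝ), IsConvexOn K g ∧ ∀ s : K, g s = l s + c :=
    fun l c => ⟨⟨fun s : K => l s + c, by fun_prop⟩, (isAffineOn_dual l c).isConvexOn,
      fun _ => rfl⟩
  have hconst : ∀ c : ℝ, IsConvexOn K (ContinuousMap.const K c) := fun c => by
    intro x y z a b _ _ hab _
    simp [← add_mul, hab]
  refine ContinuousMap.sublattice_closure_eq_top _ ⟨0, 0, 0, hconst 0, hconst 0, by simp⟩ ?_ ?_ ?_
  · rintro _ ⟨g₁, h₁, hg₁, hh₁, rfl⟩ _ ⟨g₂, h₂, hg₂, hh₂, rfl⟩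
    refine ⟨g₁ + g₂, (g₁ + h₂) ⊔ (g₂ + h₁), hg₁.add hg₂, (hg₁.add hh₂).sup (hg₂.add hh₁), ?_⟩
    ext s
    simp only [ContinuousMap.inf_apply, ContinuousMap.sub_apply, ContinuousMap.add_apply,
      ContinuousMap.sup_apply]
    rcases le_total (g₁ s - h₁ s) (g₂ s - h₂ s) with h | h
    · rw [inf_eq_left.2 h, sup_eq_right.2 (by linarith)]; ring
    · rw [inf_eq_right.2 h, sup_eq_left.2 (by linarith)]; ring
  · rintro _ ⟨g₁, h₁, hg₁, hh₁, rfl⟩ _ ⟨g₂, h₂, hg₂, hh₂, rfl⟩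
    refine ⟨(g₁ + h₂) ⊔ (g₂ + h₁), h₁ + h₂, (hg₁.add hh₂).sup (hg₂.add hh₁), hh₁.add hh₂, ?_⟩
    ext s
    simp only [ContinuousMap.sub_apply, ContinuousMap.add_apply,
      ContinuousMap.sup_apply]
    rcases le_total (g₁ s - h₁ s) (g₂ s - h₂ s) with h | h
    · rw [sup_eq_right.2 h, sup_eq_right.2 (by linarith)]; ring
    · rw [sup_eq_left.2 h, sup_eq_left.2 (by linarith)]; ring
  · intro v x y
    by_cases hxy : x = y
    · subst hxy
      exact ⟨ContinuousMap.const K (v x), ⟨_, 0, hconst _, hconst 0, (sub_zero _).symm⟩, rfl, rfl⟩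
    · obtain ⟨l, hl⟩ := geometric_hahn_banach_point_point (fun h => hxy (Subtype.ext h))
      have hne : l (y : V) - l (x : V) ≠ 0 := (sub_pos.2 hl).ne'
      obtain ⟨g, hg, hgs⟩ := haff (((v y - v x) / (l (y : V) - l (x : V))) • l)
        (v x - (v y - v x) / (l (y : V) - l (x : V)) * l (x : V))
      refine ⟨g, ⟨g, 0, hg, hconst 0, by simp⟩, ?_, ?_⟩
      · simp [hgs]
      · simp only [hgs, smul_apply, smul_eq_mul]
        field_simp
        ring

variable [MeasurableSpace V] [BorelSpace V]

lemma IsProb.ext_of_isConvexOn {μ ν : Measure K} (hμ : IsProb μ) (hν : IsProb ν)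
    (h : ∀ f : C(K, ℝ), IsConvexOn K f → ∫ t, f t ∂μ = ∫ t, f t ∂ν) : μ = ν := by
  have := hμ.1
  have := hν.1
  refine Measure.Regular.ext_of_integral_continuousMap hμ.2 hν.2 fun f => ?_
  have hcl : IsClosed {f : C(K, ℝ) | ∫ t, f t ∂μ = ∫ t, f t ∂ν} :=
    isClosed_eq (continuous_integral_continuousMap μ) (continuous_integral_continuousMap ν)
  have hf : f ∈ closure {f : C(K, ℝ) | ∃ g h : C(K, ℝ), IsConvexOn K g ∧ IsConvexOn K h ∧
      f = g - h} := by
    rw [dense_sub_isConvexOn]; trivial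
  refine (hcl.closure_subset_iff.2 ?_) hf
  rintro _ ⟨g, k, hg, hk, rfl⟩
  simp only [Set.mem_ofPred_eq, ContinuousMap.sub_apply]
  rw [integral_sub (integrable_continuousMap μ g) (integrable_continuousMap μ k),
    integral_sub (integrable_continuousMap ν g) (integrable_continuousMap ν k), h g hg, h k hk]

/-- An affine function and its negative are both convex, so the dilation order fixes its integral.
-/
lemma DilationLE.represents {μ ν : Measure K} {t : K} (h : DilationLE μ ν) (hμ : Represents μ t) :
    Represents ν t := by
  intro a ha
  rw [← hμ a ha]
  refine le_antisymm ?_ (h a (IsAffineOn.isConvexOn ha))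
  have := h (-a) (IsAffineOn.isConvexOn ((A K ℝ).neg_mem ha))
  simpa [integral_neg] using this

/-- A representing measure of `t` that dominates all representing measures of `t` is the only
maximal one. -/
lemma maximal_unique_of_forall_dilationLE {N : Measure K} {t : K} (hN : IsProb N)
    (hNt : Represents N t) (hle : ∀ ν, IsProb ν → Represents ν t → DilationLE ν N) :
    (IsMaximalProb N ∧ Represents N t) ∧
      ∀ μ, IsMaximalProb μ ∧ Represents μ t → μ = N := by
  refine ⟨⟨⟨hN, fun ν hν hNν => hle ν hν (hNν.represents hNt)⟩, hNt⟩, ?_⟩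
  rintro μ ⟨hμ, hμt⟩
  have h1 := hle μ hμ.1 hμt
  have h2 := hμ.2 N hN h1
  exact hμ.1.ext_of_isConvexOn hN fun f hf => le_antisymm (h1 f hf) (h2 f hf)

end ConvexFunctions

/-! ### The ambient locally convex space -/

section Coordinates

/-- A neighbourhood of zero constrains only finitely many coordinates. On the subspace where these
vanish, `l` is bounded, hence zero. -/
lemma exists_finset_forall_eq_sum {ι : Type*} (l : (ι → ℝ) →L[ℝ] ℝ) :
    ∃ (I : Finset ι) (w : ι → ℝ), ∀ v, l v = ∑ i ∈ I, w i * v i := by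
  classical
  have h0 : l ⁻¹' Metric.ball 0 1 ∈ 𝓝 (0 : ι → ℝ) :=
    l.continuous.continuousAt.preimage_mem_nhds (by simpa using Metric.ball_mem_nhds (0 : ℝ) one_pos)
  rw [nhds_pi, Filter.mem_pi] at h0
  obtain ⟨I, hI, t, ht, hsub⟩ := h0
  have hzero : ∀ v : ι → ℝ, (∀ i ∈ I, v i = 0) → l v = 0 := by
    intro v hv
    by_contra hne
    have h1 : (2 / l v) • v ∈ I.pi t := fun i hi => by
      simpa [hv i hi] using mem_of_mem_nhds (ht i)
    have h2 := hsub h1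
    simp [hne] at h2
  refine ⟨hI.toFinset, fun i => l (Pi.single i 1), fun v => ?_⟩
  have h1 := hzero (v - ∑ i ∈ hI.toFinset, v i • Pi.single i 1) fun j hj => by
    simp [Finset.sum_apply, Pi.single_apply, hj]
  rw [map_sub, map_sum, sub_eq_zero] at h1
  simpa [mul_comm] using h1

variable (L : Type u) [TopologicalSpace L]

/-- Families of reals indexed by `C(L, ℝ) ⊕ L`, with the product topology and its Borel sets. -/
def Coord : Type u := (C(L, ℝ) ⊕ L) → ℝ

namespace Coord

instance : AddCommGroup (Coord L) := inferInstanceAs (AddCommGroup ((C(L, ℝ) ⊕ L) → ℝ))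
instance : Module ℝ (Coord L) := inferInstanceAs (Module ℝ ((C(L, ℝ) ⊕ L) → ℝ))
instance : TopologicalSpace (Coord L) := inferInstanceAs (TopologicalSpace ((C(L, ℝ) ⊕ L) → ℝ))
instance : IsTopologicalAddGroup (Coord L) :=
  inferInstanceAs (IsTopologicalAddGroup ((C(L, ℝ) ⊕ L) → ℝ))
instance : ContinuousSMul ℝ (Coord L) := inferInstanceAs (ContinuousSMul ℝ ((C(L, ℝ) ⊕ L) → ℝ))
instance : LocallyConvexSpace ℝ (Coord L) :=
  inferInstanceAs (LocallyConvexSpace ℝ ((C(L, ℝ) ⊕ L) → ℝ))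
instance : T2Space (Coord L) := inferInstanceAs (T2Space ((C(L, ℝ) ⊕ L) → ℝ))
-- On an uncountable product the product σ-algebra is smaller than the Borel one; hence the type
-- synonym.
instance : MeasurableSpace (Coord L) := borel _
instance : BorelSpace (Coord L) := ⟨rfl⟩

variable {L}

/-- The coordinate functionals. -/
def proj (i : C(L, ℝ) ⊕ L) : Coord L →L[ℝ] ℝ :=
  ContinuousLinearMap.proj (R := ℝ) (φ := fun _ : C(L, ℝ) ⊕ L => ℝ) i

/-- The part of a family indexed by `C(L, ℝ)`. -/
def base (g : C(L, ℝ)) : Coord L →L[ℝ] ℝ := proj (Sum.inl g)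

/-- The part of a family indexed by `L`. -/
def quill (l : L) : Coord L →L[ℝ] ℝ := proj (Sum.inr l)

/-- The family with given parts. -/
def mk (φ : C(L, ℝ) → ℝ) (b : L → ℝ) : Coord L := Sum.elim φ b

@[simp] lemma base_mk (φ : C(L, ℝ) → ℝ) (b : L → ℝ) (g : C(L, ℝ)) : base g (mk φ b) = φ g := rfl

@[simp] lemma quill_mk (φ : C(L, ℝ) → ℝ) (b : L → ℝ) (l : L) : quill l (mk φ b) = b l := rfl

@[ext] lemma ext {s t : Coord L} (h1 : ∀ g, base g s = base g t)
    (h2 : ∀ l, quill l s = quill l t) : s = t := by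
  funext i
  rcases i with g | l
  exacts [h1 g, h2 l]

lemma continuous_mk {X : Type*} [TopologicalSpace X] {φ : X → C(L, ℝ) → ℝ} {b : X → L → ℝ}
    (h1 : ∀ g, Continuous fun x => φ x g) (h2 : ∀ l, Continuous fun x => b x l) :
    Continuous fun x => mk (φ x) (b x) := by
  refine continuous_pi fun i => ?_
  rcases i with g | l
  exacts [h1 g, h2 l]

lemma tendsto_nhds {X : Type*} {F : Filter X} {f : X → Coord L} {s : Coord L}
    (h1 : ∀ g, Filter.Tendsto (fun x => base g (f x)) F (𝓝 (base g s)))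
    (h2 : ∀ l, Filter.Tendsto (fun x => quill l (f x)) F (𝓝 (quill l s))) :
    Filter.Tendsto f F (𝓝 s) := by
  refine tendsto_pi_nhds.2 fun i => ?_
  rcases i with g | l
  exacts [h1 g, h2 l]

lemma induction_dual {p : (Coord L →L[ℝ] ℝ) → Prop} (h0 : p 0)
    (hadd : ∀ l m, p l → p m → p (l + m)) (hsmul : ∀ (c : ℝ) l, p l → p (c • l))
    (hbase : ∀ g, p (base g)) (hquill : ∀ l, p (quill l)) (l : Coord L →L[ℝ] ℝ) : p l := by
  classical
  obtain ⟨I, w, hl⟩ := exists_finset_forall_eq_sum (ι := C(L, ℝ) ⊕ L) l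
  have : l = ∑ i ∈ I, w i • proj i := by
    refine ContinuousLinearMap.ext fun v => (hl v).trans ?_
    rw [sum_apply]
    rfl
  rw [this]
  refine Finset.sum_induction _ p hadd h0 fun i _ => hsmul _ _ ?_
  rcases i with g | l
  exacts [hbase g, hquill l]

end Coord

end Coordinates

/-! ### The porcupine as a compact convex set -/

section Porcupine

open Coord

variable {L : Type u} [TopologicalSpace L]

variable (L) in
/-- The pairs `(φ, b)` of a state `φ` of `C(L, ℝ)` and a function `b` on `L` such that `|b l|` is at
most the mass of `φ` at `l`, for all `l`. -/
def porcupine : Set (Coord L) :=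
  {s | (∀ f g, base (f + g) s = base f s + base g s) ∧ (∀ (c : ℝ) f, base (c • f) s = c * base f s) ∧
    base 1 s = 1 ∧ ∀ l g, 0 ≤ g → |quill l s| * g l ≤ base g s}

/-- The state underlying a point of the porcupine. -/
def state (s : porcupine L) : C(L, ℝ) →ₗ[ℝ] ℝ where
  toFun g := base g (s : Coord L)
  map_add' := s.2.1
  map_smul' := s.2.2.1

lemma state_apply (s : porcupine L) (g : C(L, ℝ)) : state s g = base g (s : Coord L) := rfl

lemma state_one (s : porcupine L) : state s 1 = 1 := s.2.2.2.1

lemma abs_quill_mul_le (s : porcupine L) (l : L) {g : C(L, ℝ)} (hg : 0 ≤ g) :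
    |quill l (s : Coord L)| * g l ≤ state s g := s.2.2.2.2 l g hg

/-- Positivity is not a separate clause of the definition: the hair bound at any one point of `L`
gives it. -/
lemma state_nonneg [Nonempty L] (s : porcupine L) {g : C(L, ℝ)} (hg : 0 ≤ g) : 0 ≤ state s g :=
  (mul_nonneg (abs_nonneg _) (hg (Classical.arbitrary L))).trans (abs_quill_mul_le s _ hg)

lemma state_mono [Nonempty L] (s : porcupine L) {f g : C(L, ℝ)} (h : f ≤ g) :
    state s f ≤ state s g := by
  have := state_nonneg s (sub_nonneg.2 h)
  rwa [map_sub, sub_nonneg] at this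

lemma abs_state_le [CompactSpace L] [Nonempty L] (s : porcupine L) (g : C(L, ℝ)) :
    |state s g| ≤ ‖g‖ := by
  have h1 : g ≤ ‖g‖ • 1 := fun x => by simpa using (le_abs_self _).trans (g.norm_coe_le_norm x)
  have h2 : (-‖g‖) • 1 ≤ g := fun x => by
    simpa using neg_le_of_abs_le (g.norm_coe_le_norm x)
  have h3 := state_mono s h1
  have h4 := state_mono s h2
  rw [map_smul, state_one, smul_eq_mul, mul_one] at h3 h4
  exact abs_le.2 ⟨h4, h3⟩

lemma convex_porcupine : Convex ℝ (porcupine L) := by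
  rintro s ⟨hs1, hs2, hs3, hs4⟩ t ⟨ht1, ht2, ht3, ht4⟩ a b ha hb hab
  refine ⟨fun f g => ?_, fun c f => ?_, ?_, fun l g hg => ?_⟩
  · simp only [map_add, map_smul, hs1, ht1, smul_eq_mul]; ring
  · simp only [map_add, map_smul, hs2, ht2, smul_eq_mul]; ring
  · simp only [map_add, map_smul, hs3, ht3, smul_eq_mul, mul_one, hab]
  · simp only [map_add, map_smul, smul_eq_mul]
    calc |a * quill l s + b * quill l t| * g l
        ≤ (a * |quill l s| + b * |quill l t|) * g l := by
          refine mul_le_mul_of_nonneg_right ((abs_add_le _ _).trans ?_) (hg l)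
          rw [abs_mul, abs_mul, abs_of_nonneg ha, abs_of_nonneg hb]
      _ = a * (|quill l s| * g l) + b * (|quill l t| * g l) := by ring
      _ ≤ _ := add_le_add (mul_le_mul_of_nonneg_left (hs4 l g hg) ha)
        (mul_le_mul_of_nonneg_left (ht4 l g hg) hb)

/-- The mass at a point is not continuous in the state. Testing the hair bound against every `g ≥ 0`
replaces it by a family of closed conditions. -/
lemma isClosed_porcupine : IsClosed (porcupine L) := by
  refine IsClosed.inter ?_ (IsClosed.inter ?_ (IsClosed.inter ?_ ?_))
  · change IsClosed {s : Coord L | ∀ f g, _}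
    simp only [Set.ofPred_forall]
    exact isClosed_iInter fun f => isClosed_iInter fun g => isClosed_eq (by fun_prop) (by fun_prop)
  · change IsClosed {s : Coord L | ∀ (c : ℝ) f, _}
    simp only [Set.ofPred_forall]
    exact isClosed_iInter fun f => isClosed_iInter fun g => isClosed_eq (by fun_prop) (by fun_prop)
  · exact isClosed_eq (by fun_prop) (by fun_prop)
  · change IsClosed {s : Coord L | ∀ l g, _}
    simp only [Set.ofPred_forall]
    exact isClosed_iInter fun f => isClosed_iInter fun g => isClosed_iInter fun _ =>
      isClosed_le (by fun_prop) (by fun_prop)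

lemma isCompact_porcupine [CompactSpace L] [Nonempty L] : IsCompact (porcupine L) := by
  have h : IsCompact (Set.univ.pi (Sum.elim (fun g : C(L, ℝ) => Set.Icc (-‖g‖) ‖g‖)
      fun _ : L => Set.Icc (-1 : ℝ) 1)) := isCompact_univ_pi fun i => by
    rcases i with g | l <;> exact isCompact_Icc
  refine h.of_isClosed_subset isClosed_porcupine fun s hs i _ => ?_
  rcases i with g | l
  · exact abs_le.1 (abs_state_le ⟨s, hs⟩ g)
  · have := abs_quill_mul_le ⟨s, hs⟩ l zero_le_one
    rw [state_one] at this
    exact abs_le.1 (show |quill l s| ≤ 1 by simpa using this)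

instance [CompactSpace L] [Nonempty L] : CompactSpace (porcupine L) :=
  isCompact_iff_compactSpace.1 isCompact_porcupine

open Classical in
/-- The point `(δ_l, c 1_l)`. -/
def hair (l : L) (c : ℝ) (hc : |c| ≤ 1) : porcupine L :=
  ⟨mk (fun g => g l) (fun m => if m = l then c else 0), fun f g => by simp, fun c f => by simp,
    by simp, fun m g hg => by
      by_cases h : m = l
      · simpa [h] using mul_le_of_le_one_left (hg l) hc
      · simpa [h] using hg l⟩

@[simp] lemma base_hair (l : L) (c : ℝ) (hc : |c| ≤ 1) (g : C(L, ℝ)) :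
    base g (hair l c hc : Coord L) = g l := rfl

lemma quill_hair_self (l : L) (c : ℝ) (hc : |c| ≤ 1) :
    quill l (hair l c hc : Coord L) = c := by simp [hair]

lemma quill_hair_of_ne {l m : L} (h : m ≠ l) (c : ℝ) (hc : |c| ≤ 1) :
    quill m (hair l c hc : Coord L) = 0 := by simp [hair, h]

variable (L) in
/-- The embedding `l ↦ (δ_l, 0)`. -/
def body : C(L, porcupine L) where
  toFun l := hair l 0 (by simp)
  continuous_toFun := by
    refine Continuous.subtype_mk (Coord.continuous_mk (fun g => g.continuous) fun m => ?_) _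
    simpa using continuous_const

@[simp] lemma base_body (l : L) (g : C(L, ℝ)) : base g (body L l : Coord L) = g l := rfl

@[simp] lemma quill_body (l m : L) : quill m (body L l : Coord L) = 0 := by
  simp [body, hair]

/-- The point `(δ_l, 1_l)`. -/
def tipPos (l : L) : porcupine L := hair l 1 (by simp)

/-- The point `(δ_l, -1_l)`. -/
def tipNeg (l : L) : porcupine L := hair l (-1) (by simp)

end Porcupine

/-! ### The maximal measure of each point -/

section BoundaryMeasures

open Coord

variable {L : Type u} [TopologicalSpace L] [CompactSpace L] [T2Space L] [Nonempty L]

section Mass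

variable [MeasurableSpace L] [BorelSpace L]

/-- The measure on `L` associated with the state of a point of the porcupine. -/
def stateMeasure (s : porcupine L) : Measure L :=
  (exists_regular_integral_eq (state s) fun _ hf => state_nonneg s hf).choose

instance (s : porcupine L) : IsFiniteMeasure (stateMeasure s) :=
  (exists_regular_integral_eq (state s) fun _ hf => state_nonneg s hf).choose_spec.1

instance (s : porcupine L) : (stateMeasure s).Regular :=
  (exists_regular_integral_eq (state s) fun _ hf => state_nonneg s hf).choose_spec.2.1

lemma integral_stateMeasure (s : porcupine L) (f : C(L, ℝ)) :
    ∫ x, f x ∂stateMeasure s = state s f :=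
  (exists_regular_integral_eq (state s) fun _ hf => state_nonneg s hf).choose_spec.2.2 f

instance (s : porcupine L) : IsProbabilityMeasure (stateMeasure s) := by
  have h := integral_stateMeasure s 1
  rw [state_one] at h
  simp only [ContinuousMap.one_apply, integral_const, smul_eq_mul, mul_one] at h
  exact ⟨(ENNReal.toReal_eq_one_iff _).1 h⟩

/-- The mass of the state of `s` at `l`. -/
def mass (s : porcupine L) (l : L) : ℝ := (stateMeasure s).real {l}

lemma mass_nonneg (s : porcupine L) (l : L) : 0 ≤ mass s l := measureReal_nonneg

lemma exists_state_lt_mass_add (s : porcupine L) (l : L) {ε : ℝ} (hε : 0 < ε) :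
    ∃ g : C(L, ℝ), 0 ≤ g ∧ g l = 1 ∧ state s g < mass s l + ε := by
  obtain ⟨g, h0, h1, h2⟩ := exists_integral_lt_measureReal_singleton_add (stateMeasure s) l hε
  exact ⟨g, h0, h1, by rwa [← integral_stateMeasure]⟩

lemma sum_mass_mul_le (s : porcupine L) (S : Finset L) {f : C(L, ℝ)} (hf : 0 ≤ f) :
    ∑ l ∈ S, mass s l * f l ≤ state s f := by
  have h := integrable_continuousMap (stateMeasure s) f
  rw [← integral_stateMeasure]
  calc ∑ l ∈ S, mass s l * f l = ∫ x in (S : Set L), f x ∂stateMeasure s := by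
        rw [setIntegral_finset S h.integrableOn]
        rfl
    _ ≤ _ := setIntegral_le_integral h (.of_forall hf)

lemma mass_mul_le (s : porcupine L) (l : L) {f : C(L, ℝ)} (hf : 0 ≤ f) :
    mass s l * f l ≤ state s f := by
  simpa using sum_mass_mul_le s {l} hf

lemma sum_mass_le (s : porcupine L) (S : Finset L) : ∑ l ∈ S, mass s l ≤ 1 := by
  simpa [state_one] using sum_mass_mul_le s S (f := 1) zero_le_one

lemma summable_mass (s : porcupine L) : Summable (mass s) :=
  summable_of_sum_le (mass_nonneg s) (sum_mass_le s)

lemma tsum_mass_le (s : porcupine L) : ∑' l, mass s l ≤ 1 :=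
  (summable_mass s).tsum_le_of_sum_le (sum_mass_le s)

/-- The mass at `l` is the infimum of the state over `g ≥ 0` with `g l = 1`. -/
lemma abs_quill_le_mass (s : porcupine L) (l : L) : |quill l (s : Coord L)| ≤ mass s l := by
  refine le_of_forall_pos_le_add fun ε hε => ?_
  obtain ⟨g, hg0, hgl, hg⟩ := exists_state_lt_mass_add s l hε
  have := abs_quill_mul_le s l hg0
  rw [hgl, mul_one] at this
  exact this.trans hg.le

end Mass

/-- The second difference of `f` along the hair at `l`. -/
def evenPart (f : C(porcupine L, ℝ)) (l : L) : ℝ :=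
  (f (tipPos l) + f (tipNeg l) - 2 * f (body L l)) / 2

/-- The slope of `f` between the end points of the hair at `l`. -/
def oddPart (f : C(porcupine L, ℝ)) (l : L) : ℝ := (f (tipPos l) - f (tipNeg l)) / 2

lemma abs_evenPart_le (f : C(porcupine L, ℝ)) (l : L) : |evenPart f l| ≤ 2 * ‖f‖ := by
  have h1 := abs_le.1 (f.norm_coe_le_norm (tipPos l))
  have h2 := abs_le.1 (f.norm_coe_le_norm (tipNeg l))
  have h3 := abs_le.1 (f.norm_coe_le_norm (body L l))
  rw [evenPart, abs_le]
  constructor <;> linarith [h1.1, h1.2, h2.1, h2.2, h3.1, h3.2]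

lemma abs_oddPart_le (f : C(porcupine L, ℝ)) (l : L) : |oddPart f l| ≤ ‖f‖ := by
  have h1 := abs_le.1 (f.norm_coe_le_norm (tipPos l))
  have h2 := abs_le.1 (f.norm_coe_le_norm (tipNeg l))
  rw [oddPart, abs_le]
  constructor <;> linarith [h1.1, h1.2, h2.1, h2.2]

/-- The two points differ only in the coordinate `quill l`, and along a free ultrafilter `l`
eventually leaves every fixed index. By compactness both therefore converge to the same point. -/
lemma tendsto_hair_sub_body {c : ℝ} (hc : |c| ≤ 1) (f : C(porcupine L, ℝ)) :
    Filter.Tendsto (fun l => f (hair l c hc) - f (body L l)) Filter.cofinite (𝓝 0) := by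
  rw [Filter.tendsto_iff_ultrafilter]
  intro U hU
  have hp : Filter.Tendsto (body L) U (𝓝 (U.map (body L)).lim) := (U.map (body L)).le_nhds_lim
  set p := (U.map (body L)).lim
  have hq : Filter.Tendsto (fun l => hair l c hc) U (𝓝 p) := by
    have hp' := (continuous_subtype_val.tendsto p).comp hp
    refine tendsto_subtype_rng.2 (Coord.tendsto_nhds (fun g => ?_) fun m => ?_)
    · have := ((base g).continuous.tendsto (p : Coord L)).comp hp'
      exact this
    · refine (((quill m).continuous.tendsto _).comp hp').congr' ?_
      filter_upwards [hU (Filter.eventually_cofinite_ne m)] with l hl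
      simp [quill_hair_of_ne (Ne.symm hl)]
  simpa using ((f.continuous.tendsto p).comp hq).sub ((f.continuous.tendsto p).comp hp)

lemma tendsto_evenPart (f : C(porcupine L, ℝ)) :
    Filter.Tendsto (evenPart f) Filter.cofinite (𝓝 0) := by
  have h := ((tendsto_hair_sub_body (c := 1) (by simp) f).add
    (tendsto_hair_sub_body (c := -1) (by simp) f)).div_const 2
  simp only [add_zero, zero_div] at h
  refine h.congr fun l => ?_
  simp only [evenPart, tipPos, tipNeg]
  ring

lemma tendsto_oddPart (f : C(porcupine L, ℝ)) :
    Filter.Tendsto (oddPart f) Filter.cofinite (𝓝 0) := by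
  have h := ((tendsto_hair_sub_body (c := 1) (by simp) f).sub
    (tendsto_hair_sub_body (c := -1) (by simp) f)).div_const 2
  simp only [sub_zero, zero_div] at h
  refine h.congr fun l => ?_
  simp only [oddPart, tipPos, tipNeg]
  ring

/-- The body point is the midpoint of the two tips. -/
lemma evenPart_nonneg {f : C(porcupine L, ℝ)} (hf : IsConvexOn (porcupine L) f) (l : L) :
    0 ≤ evenPart f l := by
  have := hf (tipPos l) (tipNeg l) (body L l) (1 / 2) (1 / 2) (by norm_num) (by norm_num)
    (by norm_num) (by
      ext m
      · simp only [map_add, map_smul, tipPos, tipNeg, base_hair, base_body, smul_eq_mul]; ring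
      · by_cases h : m = l
        · subst h
          simp [tipPos, tipNeg, quill_hair_self]
        · simp [tipPos, tipNeg, quill_hair_of_ne h])
  rw [evenPart]
  linarith

/-- The restriction of a continuous linear functional to the porcupine. -/
def restrictDual (l : Coord L →L[ℝ] ℝ) : C(porcupine L, ℝ) :=
  ⟨fun s => l s, l.continuous.comp continuous_subtype_val⟩

@[simp] lemma restrictDual_apply (l : Coord L →L[ℝ] ℝ) (s : porcupine L) :
    restrictDual l s = l s := rfl

variable [MeasurableSpace L] [BorelSpace L]

/-- The contribution of the hair at `l` to `boundaryFunctional`. -/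
def hairTerm (s : porcupine L) (f : C(porcupine L, ℝ)) (l : L) : ℝ :=
  mass s l * evenPart f l + quill l (s : Coord L) * oddPart f l

lemma abs_hairTerm_le (s : porcupine L) (f : C(porcupine L, ℝ)) (l : L) {C D : ℝ}
    (hC : |evenPart f l| ≤ C) (hD : |oddPart f l| ≤ D) :
    |hairTerm s f l| ≤ (C + D) * mass s l := by
  refine (abs_add_le _ _).trans ?_
  rw [abs_mul, abs_mul, abs_of_nonneg (mass_nonneg s l)]
  have h1 := mul_le_mul_of_nonneg_left hC (mass_nonneg s l)
  have h2 := mul_le_mul (abs_quill_le_mass s l) hD (abs_nonneg _) (mass_nonneg s l)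
  linarith

lemma summable_hairTerm (s : porcupine L) (f : C(porcupine L, ℝ)) : Summable (hairTerm s f) :=
  Summable.of_norm_bounded ((summable_mass s).mul_left _)
    fun l => abs_hairTerm_le s f l (abs_evenPart_le f l) (abs_oddPart_le f l)

/-- Integration against the measure obtained from the state measure of `s` by moving each point mass
to the end points of its hair, in the proportions prescribed by `s`. -/
def boundaryFunctional (s : porcupine L) : C(porcupine L, ℝ) →ₗ[ℝ] ℝ where
  toFun f := state s (f.comp (body L)) + ∑' l, hairTerm s f l
  map_add' f g := by
    rw [ContinuousMap.add_comp, map_add, add_add_add_comm,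
      ← (summable_hairTerm s f).tsum_add (summable_hairTerm s g)]
    congr 2
    funext l
    simp only [hairTerm, evenPart, oddPart, ContinuousMap.add_apply]
    ring
  map_smul' c f := by
    rw [ContinuousMap.smul_comp, map_smul, RingHom.id_apply, smul_add, smul_eq_mul, smul_eq_mul,
      ← tsum_mul_left]
    congr 2
    funext l
    simp only [hairTerm, evenPart, oddPart, ContinuousMap.smul_apply, smul_eq_mul]
    ring

lemma boundaryFunctional_apply (s : porcupine L) (f : C(porcupine L, ℝ)) :
    boundaryFunctional s f = state s (f.comp (body L)) + ∑' l, hairTerm s f l := rfl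

/-- The state dominates its atomic part `∑ m_l f(body l)`. Adding `m_l f(body l)` to the hair term
at `l` leaves `((m_l + b_l) f(tip⁺) + (m_l - b_l) f(tip⁻)) / 2`, which is nonnegative since `|b_l| ≤
m_l`. -/
lemma boundaryFunctional_nonneg (s : porcupine L) (f : C(porcupine L, ℝ)) (hf : 0 ≤ f) :
    0 ≤ boundaryFunctional s f := by
  have hf0 : 0 ≤ f.comp (body L) := fun l => hf _
  have hs : Summable fun l => mass s l * f.comp (body L) l :=
    summable_of_sum_le (fun l => mul_nonneg (mass_nonneg s l) (hf0 l))
      fun S => sum_mass_mul_le s S hf0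
  have h1 : ∑' l, mass s l * f.comp (body L) l ≤ state s (f.comp (body L)) :=
    hs.tsum_le_of_sum_le fun S => sum_mass_mul_le s S hf0
  have h2 : ∑' l, -(mass s l * f.comp (body L) l) ≤ ∑' l, hairTerm s f l := by
    refine hs.neg.tsum_le_tsum (fun l => ?_) (summable_hairTerm s f)
    obtain ⟨h3, h4⟩ := abs_le.1 (abs_quill_le_mass s l)
    have h5 := mul_nonneg (neg_le_iff_add_nonneg.1 h3) (show 0 ≤ f (tipPos l) from hf _)
    have h6 := mul_nonneg (sub_nonneg.2 h4) (show 0 ≤ f (tipNeg l) from hf _)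
    simp only [hairTerm, evenPart, oddPart, ContinuousMap.comp_apply]
    linarith
  rw [tsum_neg] at h2
  rw [boundaryFunctional_apply]
  linarith

lemma boundaryFunctional_one (s : porcupine L) : boundaryFunctional s 1 = 1 := by
  have : hairTerm s 1 = 0 := by
    funext l
    simp only [hairTerm, evenPart, oddPart, ContinuousMap.one_apply, Pi.zero_apply]
    ring
  rw [boundaryFunctional_apply, this, ContinuousMap.one_comp, state_one]
  simp

lemma boundaryFunctional_restrictDual (s : porcupine L) (l : Coord L →L[ℝ] ℝ) :
    boundaryFunctional s (restrictDual l) = l s := by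
  induction l using Coord.induction_dual with
  | h0 => exact map_zero (boundaryFunctional s)
  | hadd l m hl hm => exact (map_add (boundaryFunctional s) (restrictDual l) (restrictDual m)).trans <|
      (by rw [hl, hm]; rfl)
  | hsmul c l hl => exact (map_smul (boundaryFunctional s) c (restrictDual l)).trans <|
      (by rw [hl]; rfl)
  | hbase g =>
    have : hairTerm s (restrictDual (base g)) = 0 := by
      funext l
      simp only [hairTerm, evenPart, oddPart, restrictDual_apply, tipPos, tipNeg, base_hair,
        base_body, Pi.zero_apply]
      ring
    rw [boundaryFunctional_apply, this]
    simp only [Pi.zero_apply, tsum_zero, add_zero]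
    rfl
  | hquill m =>
    have h0 : (restrictDual (quill m)).comp (body L) = 0 := by ext l; simp
    rw [boundaryFunctional_apply, h0, map_zero, zero_add, tsum_eq_single m]
    · simp [hairTerm, evenPart, oddPart, tipPos, tipNeg, quill_hair_self]
    · intro l hl
      simp [hairTerm, evenPart, oddPart, tipPos, tipNeg, quill_hair_of_ne hl.symm]

lemma boundaryFunctional_mono (s : porcupine L) {f g : C(porcupine L, ℝ)} (h : f ≤ g) :
    boundaryFunctional s f ≤ boundaryFunctional s g := by
  have := boundaryFunctional_nonneg s _ (sub_nonneg.2 h)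
  rwa [map_sub, sub_nonneg] at this

/-- Jensen's inequality: the functional is positive and unital, and reproduces continuous linear
functionals at `s`; apply it to affine minorants of `f`. -/
lemma le_boundaryFunctional (s : porcupine L) {f : C(porcupine L, ℝ)}
    (hf : IsConvexOn (porcupine L) f) : f s ≤ boundaryFunctional s f := by
  refine le_of_forall_lt_imp_le_of_dense fun r hr => ?_
  obtain ⟨l, c, h1, h2⟩ := hf.exists_affine_le convex_porcupine s hr
  have h3 : restrictDual l + c • 1 ≤ f := fun z => by simpa using h1 z
  have := boundaryFunctional_mono s h3
  rw [map_add, map_smul, boundaryFunctional_one, boundaryFunctional_restrictDual, smul_eq_mul,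
    mul_one] at this
  linarith

/-- The measure of `boundaryFunctional`. -/
def boundaryMeasure (s : porcupine L) : Measure (porcupine L) :=
  (exists_regular_integral_eq _ (boundaryFunctional_nonneg s)).choose

instance (s : porcupine L) : IsFiniteMeasure (boundaryMeasure s) :=
  (exists_regular_integral_eq _ (boundaryFunctional_nonneg s)).choose_spec.1

lemma integral_boundaryMeasure (s : porcupine L) (f : C(porcupine L, ℝ)) :
    ∫ x, f x ∂boundaryMeasure s = boundaryFunctional s f :=
  (exists_regular_integral_eq _ (boundaryFunctional_nonneg s)).choose_spec.2.2 f

lemma isProb_boundaryMeasure (s : porcupine L) : IsProb (boundaryMeasure s) := by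
  refine ⟨?_, (exists_regular_integral_eq _ (boundaryFunctional_nonneg s)).choose_spec.2.1⟩
  have h := integral_boundaryMeasure s 1
  rw [boundaryFunctional_one] at h
  simp only [ContinuousMap.one_apply, integral_const, smul_eq_mul, mul_one] at h
  exact ⟨(ENNReal.toReal_eq_one_iff _).1 h⟩

/-- A continuous affine function on the porcupine need not extend to a continuous functional, so
Jensen is applied to `a` and `-a`. -/
lemma represents_boundaryMeasure (s : porcupine L) : Represents (boundaryMeasure s) s := by
  intro a ha
  rw [integral_boundaryMeasure]
  have h1 := le_boundaryFunctional s (IsAffineOn.isConvexOn ha)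
  have h2 := le_boundaryFunctional s (IsAffineOn.isConvexOn ((A _ ℝ).neg_mem ha))
  rw [map_neg, ContinuousMap.neg_apply] at h2
  linarith

/-- For convex `f`, a continuous affine majorant is built whose value at `t` nearly equals
`boundaryFunctional t f`; integrating it against `ν` finishes. Outside a finite set of hairs `f` is
almost constant along the hair. On the remaining ones the discontinuous mass is replaced by `state s
(g l)`, which is at least the mass for every `s` and almost equal to it at `t`. As `evenPart f l ≥
0`, this overestimate goes in the right direction. -/
lemma dilationLE_boundaryMeasure {ν : Measure (porcupine L)} {t : porcupine L} (hν : IsProb ν)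
    (hνt : Represents ν t) : DilationLE ν (boundaryMeasure t) := by
  classical
  intro f hf
  have := hν.1
  rw [integral_boundaryMeasure]
  refine le_of_forall_pos_le_add fun ε' hε' => ?_
  -- Budget: `2ε` for the tail in the majorant, `ε` for replacing masses at `t`, `2ε` for restoring
  -- the tail at `t`.
  obtain ⟨ε, hε, rfl⟩ : ∃ ε, 0 < ε ∧ ε' = 5 * ε := ⟨ε' / 5, by positivity, by ring⟩
  obtain ⟨S, hS⟩ : ∃ S : Finset L, ∀ l ∉ S, |evenPart f l| ≤ ε ∧ |oddPart f l| ≤ ε := by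
    have h1 := (tendsto_evenPart f).eventually (Metric.closedBall_mem_nhds 0 hε)
    have h2 := (tendsto_oddPart f).eventually (Metric.closedBall_mem_nhds 0 hε)
    refine ⟨(Filter.eventually_cofinite.1 (h1.and h2)).toFinset, fun l hl => ?_⟩
    simpa using hl
  have hterm : ∀ s, ∀ l ∉ S, |hairTerm s f l| ≤ 2 * ε * mass s l := fun s l hl => by
    simpa [two_mul] using abs_hairTerm_le s f l (hS l hl).1 (hS l hl).2
  have hsum0 : 0 ≤ ∑ l ∈ S, evenPart f l := Finset.sum_nonneg fun l _ => evenPart_nonneg hf l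
  -- Chosen so that mass errors `δ` weighted by the even parts add up to at most `ε`; the `1 +`
  -- keeps the denominator positive.
  set δ := ε / (1 + ∑ l ∈ S, evenPart f l) with hδ
  have hδ0 : 0 < δ := by positivity
  choose g hg0 hg1 hg using fun l => exists_state_lt_mass_add t l hδ0
  let F : Coord L →L[ℝ] ℝ := base (f.comp (body L)) +
    ∑ l ∈ S, (evenPart f l • base (g l) + oddPart f l • quill l)
  have hF : ∀ s : porcupine L, F s = state s (f.comp (body L)) +
      ∑ l ∈ S, (evenPart f l * state s (g l) + oddPart f l * quill l (s : Coord L)) := fun s => by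
    simp [F, state_apply, sum_apply]
  have hsum : ∀ (s : porcupine L) (x : L → ℝ),
      HasSum (fun l => (if l ∈ S then x l else 0) + 2 * ε * mass s l)
        (∑ l ∈ S, x l + 2 * ε * ∑' l, mass s l) := fun s x => by
    refine HasSum.add ?_ ((summable_mass s).hasSum.mul_left _)
    have := hasSum_sum_of_ne_finset_zero (f := fun l => if l ∈ S then x l else 0) (s := S)
      (L := .unconditional L) fun l hl => if_neg hl
    rwa [Finset.sum_congr rfl fun l hl => if_pos hl] at this
  have hmass : ∀ s : porcupine L, 2 * ε * ∑' l, mass s l ≤ 2 * ε := fun s =>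
    mul_le_of_le_one_right (by positivity) (tsum_mass_le s)
  have hfF : ∀ s : porcupine L, f s ≤ F s + 2 * ε := fun s => by
    refine (le_boundaryFunctional s hf).trans ?_
    rw [boundaryFunctional_apply, hF, add_assoc]
    refine add_le_add_right ((hasSum_le (fun l => ?_) (summable_hairTerm s f).hasSum
      (hsum s fun l => evenPart f l * state s (g l) + oddPart f l * quill l (s : Coord L))).trans
      (add_le_add_right (hmass s) _)) _
    by_cases hl : l ∈ S
    · rw [if_pos hl, hairTerm]
      have h1 := mass_mul_le s l (hg0 l)
      rw [hg1, mul_one] at h1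
      have h2 := mul_le_mul_of_nonneg_left h1 (evenPart_nonneg hf l)
      have h3 := mul_nonneg hε.le (mass_nonneg s l)
      linarith
    · rw [if_neg hl, zero_add]
      exact (abs_le.1 (hterm s l hl)).2
  have h1 : ∫ s, f s ∂ν ≤ F t + 2 * ε := by
    have hG : (restrictDual F + (2 * ε) • 1 : C(porcupine L, ℝ)) ∈ A (porcupine L) ℝ := by
      have := isAffineOn_dual (K := porcupine L) F (2 * ε)
      intro x y z a b ha hb hab hz
      simpa using this x y z a b ha hb hab hz
    have h2 := hνt _ hG
    simp only [ContinuousMap.add_apply, restrictDual_apply, ContinuousMap.smul_apply,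
      ContinuousMap.one_apply, smul_eq_mul, mul_one] at h2
    rw [← h2]
    refine integral_mono (integrable_continuousMap ν f) ?_ hfF
    exact (integrable_continuousMap ν (restrictDual F)).add (integrable_const _)
  have h2 : ∑ l ∈ S, (evenPart f l * state t (g l) + oddPart f l * quill l (t : Coord L)) ≤
      ∑ l ∈ S, hairTerm t f l + ε := by
    calc _ ≤ ∑ l ∈ S, (hairTerm t f l + evenPart f l * δ) := Finset.sum_le_sum fun l _ => by
          have := mul_le_mul_of_nonneg_left (hg l).le (evenPart_nonneg hf l)
          rw [hairTerm]
          linarith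
      _ = ∑ l ∈ S, hairTerm t f l + (∑ l ∈ S, evenPart f l) * δ := by
          rw [Finset.sum_add_distrib, Finset.sum_mul]
      _ ≤ _ := by
          refine add_le_add_right ?_ _
          rw [hδ, mul_div_assoc', div_le_iff₀ (by positivity)]
          nlinarith
  have h3 : ∑ l ∈ S, hairTerm t f l ≤ ∑' l, hairTerm t f l + 2 * ε := by
    have h4 := hasSum_le (fun l => by
        by_cases hl : l ∈ S
        · rw [if_pos hl]
          have := mul_nonneg hε.le (mass_nonneg t l)
          linarith
        · rw [if_neg hl, zero_add]
          exact (abs_le.1 (hterm t l hl)).1)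
      (hsum t fun l => -hairTerm t f l).neg (summable_hairTerm t f).hasSum
    rw [Finset.sum_neg_distrib] at h4
    linarith [hmass t]
  rw [boundaryFunctional_apply]
  rw [hF] at h1
  linarith

lemma isMaximalProb_boundaryMeasure (t : porcupine L) :
    (IsMaximalProb (boundaryMeasure t) ∧ Represents (boundaryMeasure t) t) ∧
      ∀ μ, IsMaximalProb μ ∧ Represents μ t → μ = boundaryMeasure t :=
  maximal_unique_of_forall_dilationLE (isProb_boundaryMeasure t) (represents_boundaryMeasure t)
    fun _ => dilationLE_boundaryMeasure

end BoundaryMeasures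

lemma isSimplex_porcupine (L : Type u) [TopologicalSpace L] [CompactSpace L] [T2Space L]
    [Nonempty L] : IsSimplex (porcupine L) := fun t => by
  let _ : MeasurableSpace L := borel L
  have _ : BorelSpace L := ⟨rfl⟩
  exact ⟨boundaryMeasure t, (isMaximalProb_boundaryMeasure t).1,
    (isMaximalProb_boundaryMeasure t).2⟩

/-! ### Complementation of `C(L, E)` -/

section VectorValued

open Coord

/-- On a norm-compact set the weak and norm topologies agree. -/
lemma continuous_of_forall_dual {X E : Type*} [TopologicalSpace X] [NormedAddCommGroup E]
    [NormedSpace ℝ E] {f : X → E} {C : Set E} (hC : IsCompact C) (hfC : ∀ x, f x ∈ C)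
    (hf : ∀ y : StrongDual ℝ E, Continuous fun x => y (f x)) : Continuous f := by
  refine continuous_iff_ultrafilter.2 fun x U hU => ?_
  obtain ⟨c, -, hc⟩ := hC.ultrafilter_le_nhds (U.map f)
    (Filter.le_principal_iff.2 (Filter.Eventually.of_forall hfC : ∀ᶠ x in (U : Filter X), f x ∈ C))
  have : c = f x := (SeparatingDual.eq_iff_forall_dual_eq (R := ℝ)).2 fun y =>
    tendsto_nhds_unique ((y.continuous.tendsto c).comp hc) (((hf y).tendsto x).mono_left hU)
  exact this ▸ hc

lemma isCompact_closure_convexHull {E : Type*} [NormedAddCommGroup E] [NormedSpace ℝ E]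
    [CompleteSpace E] {C : Set E} (hC : IsCompact C) : IsCompact (closure (convexHull ℝ C)) :=
  hC.totallyBounded.convexHull.closure.isCompact_of_isClosed isClosed_closure

variable {L : Type u} [TopologicalSpace L] [CompactSpace L] [T2Space L] [Nonempty L]
  [MeasurableSpace L] [BorelSpace L] {E : Type v} [NormedAddCommGroup E] [NormedSpace ℝ E]
  [CompleteSpace E]

lemma dual_integral_stateMeasure (s : porcupine L) (g : C(L, E)) (y : StrongDual ℝ E) :
    y (∫ x, g x ∂stateMeasure s) = state s ((y : C(E, ℝ)).comp g) := by
  rw [← integral_stateMeasure]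
  exact (y.integral_comp_comm (integrable_continuousMap _ g)).symm

/-- The map `s ↦ ∫ g dμ_s`, where `μ_s` is the state measure of `s`. -/
def integralMap (g : C(L, E)) : C(porcupine L, E) where
  toFun s := ∫ x, g x ∂stateMeasure s
  continuous_toFun := by
    -- All the integrals lie in the closed convex hull of `g(L)`, which is norm-compact, so weak
    -- continuity suffices.
    refine continuous_of_forall_dual (isCompact_closure_convexHull (isCompact_range g.continuous))
      (fun s => (convex_convexHull ℝ _).closure.integral_mem isClosed_closure (.of_forall fun x =>
        subset_closure (subset_convexHull ℝ _ (Set.mem_range_self x)))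
        (integrable_continuousMap _ g)) fun y => ?_
    simp only [dual_integral_stateMeasure]
    exact (restrictDual (base _)).continuous

lemma integralMap_apply (g : C(L, E)) (s : porcupine L) :
    integralMap g s = ∫ x, g x ∂stateMeasure s := rfl

lemma integralMap_mem (g : C(L, E)) : integralMap g ∈ A (porcupine L) E := by
  intro x y z a b _ _ _ hz
  refine (SeparatingDual.eq_iff_forall_dual_eq (R := ℝ)).2 fun φ => ?_
  simp only [map_add, map_smul, integralMap_apply, dual_integral_stateMeasure, state_apply, hz]

lemma integralMap_body (g : C(L, E)) (l : L) : integralMap g (body L l) = g l := by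
  refine (SeparatingDual.eq_iff_forall_dual_eq (R := ℝ)).2 fun φ => ?_
  rw [integralMap_apply, dual_integral_stateMeasure, state_apply, base_body]
  rfl

variable (L E) in
/-- The embedding of `C(L, E)` into `A(K, E)` by integration, for `K` the porcupine of `L`. -/
def integralEmbedding : C(L, E) →ₗᵢ[ℝ] A (porcupine L) E where
  toFun g := ⟨integralMap g, integralMap_mem g⟩
  map_add' f g := by
    ext s
    exact integral_add (integrable_continuousMap _ f) (integrable_continuousMap _ g)
  map_smul' c f := by
    ext s
    exact integral_smul c f
  norm_map' g := by
    refine le_antisymm ((ContinuousMap.norm_le _ (norm_nonneg _)).2 fun s =>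
      norm_integral_le_norm _ g) ((ContinuousMap.norm_le _ (norm_nonneg _)).2 fun l => ?_)
    rw [← integralMap_body]
    exact (integralMap g).norm_coe_le_norm _

variable (L E) in
/-- Restriction of continuous affine maps on the porcupine to `L`. -/
def restrictBody : A (porcupine L) E →ₗ[ℝ] C(L, E) where
  toFun f := (f : C(porcupine L, E)).comp (body L)
  map_add' _ _ := rfl
  map_smul' _ _ := rfl

lemma restrictBody_integralEmbedding (g : C(L, E)) :
    restrictBody L E (integralEmbedding L E g) = g := ContinuousMap.ext (integralMap_body g)

lemma norm_restrictBody_le (f : A (porcupine L) E) : ‖restrictBody L E f‖ ≤ ‖f‖ :=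
  (ContinuousMap.norm_le _ (norm_nonneg _)).2 fun _ => (f : C(porcupine L, E)).norm_coe_le_norm _

end VectorValued

lemma isOneComplementedIn_porcupine (L : Type u) [TopologicalSpace L] [CompactSpace L] [T2Space L]
    [Nonempty L] (E : Type v) [NormedAddCommGroup E] [NormedSpace ℝ E] [CompleteSpace E] :
    IsOneComplementedIn C(L, E) (A (porcupine L) E) := by
  let _ : MeasurableSpace L := borel L
  have _ : BorelSpace L := ⟨rfl⟩
  refine ⟨integralEmbedding L E, LinearMap.mkContinuous
    ((integralEmbedding L E).toLinearMap ∘ₗ restrictBody L E) 1 fun f => ?_, fun f => ?_, ?_,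
    LinearMap.mkContinuous_norm_le _ zero_le_one _⟩
  · rw [one_mul]
    exact ((integralEmbedding L E).norm_map _).trans_le (norm_restrictBody_le f)
  · exact congrArg (integralEmbedding L E) (restrictBody_integralEmbedding _)
  · refine Set.Subset.antisymm ?_ ?_
    · rintro _ ⟨f, rfl⟩
      exact ⟨restrictBody L E f, rfl⟩
    · rintro _ ⟨g, rfl⟩
      exact ⟨integralEmbedding L E g,
        congrArg (integralEmbedding L E) (restrictBody_integralEmbedding g)⟩

/-! ### Extreme points are the tips -/

section ExtremePoints

open Coord

variable {L : Type u} [TopologicalSpace L] [CompactSpace L] [T2Space L] [Nonempty L]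

/-- Reweighting by the density `h`. The densities `h` and `1 - h` exhibit `s` as a convex
combination. -/
lemma mk_mul_mem_porcupine (s : porcupine L) {h : C(L, ℝ)} (h0 : 0 ≤ h) (hs : 0 < state s h) :
    mk (fun g => state s (h * g) / state s h) (fun l => h l * quill l (s : Coord L) / state s h) ∈
      porcupine L := by
  refine ⟨fun f g => ?_, fun c f => ?_, ?_, fun l g hg => ?_⟩
  · simp [mul_add, add_div]
  · simp [mul_div_assoc]
  · simp [hs.ne']
  · simp only [quill_mk, base_mk]
    rw [abs_div, abs_mul, abs_of_nonneg hs.le, abs_of_nonneg (show 0 ≤ h l from h0 l), div_mul_eq_mul_div]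
    refine div_le_div_of_nonneg_right ?_ hs.le
    have := abs_quill_mul_le s l (mul_nonneg h0 hg)
    rw [ContinuousMap.mul_apply] at this
    linarith

lemma state_mul_eq_zero (s : porcupine L) {h : C(L, ℝ)} (h0 : 0 ≤ h) (hs : state s h = 0)
    (g : C(L, ℝ)) : state s (h * g) = 0 := by
  have h1 : h * g ≤ ‖g‖ • h := fun x => by
    have := mul_le_mul_of_nonneg_left ((le_abs_self _).trans (g.norm_coe_le_norm x)) (h0 x)
    simpa [mul_comm] using this
  have h2 : (-‖g‖) • h ≤ h * g := fun x => by
    have := mul_le_mul_of_nonneg_left (neg_le_of_abs_le (g.norm_coe_le_norm x)) (h0 x)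
    simpa [mul_comm] using this
  have h3 := state_mono s h1
  have h4 := state_mono s h2
  rw [map_smul, hs, smul_zero] at h3 h4
  exact le_antisymm h3 h4

/-- Extremality forces `s` to equal its reweighting by `h`, which is multiplicativity; the cases
where `h` or `1 - h` has state zero are degenerate. -/
lemma state_mul_of_mem_Icc {s : porcupine L}
    (hs : (s : Coord L) ∈ (porcupine L).extremePoints ℝ) {h : C(L, ℝ)} (h0 : 0 ≤ h) (h1 : h ≤ 1)
    (g : C(L, ℝ)) : state s (h * g) = state s h * state s g := by
  have h1' : 0 ≤ 1 - h := sub_nonneg.2 h1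
  have hsum : state s (1 - h) = 1 - state s h := by rw [map_sub, state_one]
  rcases (state_nonneg s h0).eq_or_lt with hp | hp
  · rw [state_mul_eq_zero s h0 hp.symm, ← hp, zero_mul]
  rcases (state_nonneg s h1').eq_or_lt with hq | hq
  · have h2 := state_mul_eq_zero s h1' hq.symm g
    rw [sub_mul, one_mul, map_sub, sub_eq_zero] at h2
    rw [hsum] at hq
    rw [← h2, ← sub_eq_zero.1 hq.symm, one_mul]
  have h3 := hs.2 (mk_mul_mem_porcupine s h0 hp) (mk_mul_mem_porcupine s h1' hq)
    ⟨state s h, state s (1 - h), hp, hq, by rw [hsum]; ring, by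
      ext
      · simp only [map_add, map_smul, base_mk, smul_eq_mul]
        rw [mul_div_cancel₀ _ hp.ne', mul_div_cancel₀ _ hq.ne', ← map_add, ← add_mul,
          add_sub_cancel, one_mul, state_apply]
      · simp only [map_add, map_smul, quill_mk, smul_eq_mul]
        rw [mul_div_cancel₀ _ hp.ne', mul_div_cancel₀ _ hq.ne', ← add_mul]
        simp⟩
  have h4 := congrArg (base g) h3
  rw [base_mk, ← state_apply, div_eq_iff hp.ne'] at h4
  rw [h4, mul_comm]

lemma state_mul {s : porcupine L} (hs : (s : Coord L) ∈ (porcupine L).extremePoints ℝ)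
    (f g : C(L, ℝ)) : state s (f * g) = state s f * state s g := by
  -- By linearity it is enough to treat functions with values in `[0, 1]`.
  obtain ⟨c, r, h, h0, h1, rfl⟩ : ∃ (c r : ℝ) (h : C(L, ℝ)), 0 ≤ h ∧ h ≤ 1 ∧ f = c • h - r • 1 := by
    have hC : 0 < 2 * ‖f‖ + 1 := by positivity
    have hb : ∀ x, -‖f‖ ≤ f x ∧ f x ≤ ‖f‖ := fun x => abs_le.1 (f.norm_coe_le_norm x)
    refine ⟨2 * ‖f‖ + 1, ‖f‖, (2 * ‖f‖ + 1)⁻¹ • (f + ‖f‖ • 1), fun x => ?_, fun x => ?_, ?_⟩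
    · change 0 ≤ (2 * ‖f‖ + 1)⁻¹ * (f x + ‖f‖ * 1)
      exact mul_nonneg (inv_nonneg.2 hC.le) (by linarith [hb x])
    · change (2 * ‖f‖ + 1)⁻¹ * (f x + ‖f‖ * 1) ≤ 1
      rw [inv_mul_le_iff₀ hC]
      linarith [hb x]
    · rw [smul_inv_smul₀ hC.ne', add_sub_cancel_right]
  have h2 := state_mul_of_mem_Icc hs h0 h1 g
  rw [sub_mul, smul_mul_assoc, smul_mul_assoc, one_mul, map_sub, map_sub, map_smul, map_smul,
    map_smul, map_smul, h2, state_one]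
  simp only [smul_eq_mul]
  ring

/-- A multiplicative state is a character of `C(L, ℝ)`, hence evaluation at some `l`; at other
points the mass, and so the hair coordinate, is zero. -/
lemma exists_eq_hair {s : porcupine L} (hs : (s : Coord L) ∈ (porcupine L).extremePoints ℝ) :
    ∃ (l : L) (c : ℝ) (hc : |c| ≤ 1), s = hair l c hc := by
  let φ : WeakDual.characterSpace ℝ C(L, ℝ) :=
    ⟨(state s).mkContinuous 1 fun g => by simpa using abs_state_le s g, fun h => by
      have h1 := state_one s
      rw [show state s 1 = 0 from DFunLike.congr_fun h (1 : C(L, ℝ))] at h1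
      exact zero_ne_one h1, state_mul hs⟩
  obtain ⟨l, hl⟩ := (WeakDual.CharacterSpace.continuousMapEval_bijective L ℝ).2 φ
  have hstate : ∀ g, state s g = g l := fun g => (DFunLike.congr_fun hl g).symm
  have hc : |quill l (s : Coord L)| ≤ 1 := by
    simpa [state_one] using abs_quill_mul_le s l zero_le_one
  refine ⟨l, quill l (s : Coord L), hc, Subtype.ext (Coord.ext hstate fun m => ?_)⟩
  by_cases hm : m = l
  · rw [hm, quill_hair_self]
  rw [quill_hair_of_ne hm]
  obtain ⟨g, hg0, hg1, hg⟩ := exists_continuous_zero_one_of_isClosed (s := {l}) (t := {m})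
    isClosed_singleton isClosed_singleton (by simpa using Ne.symm hm)
  have := abs_quill_mul_le s m (g := g) fun x => (hg x).1
  rw [hstate, hg0 rfl, hg1 rfl, Pi.one_apply, mul_one] at this
  exact abs_nonpos_iff.1 this

lemma exists_eq_tip {s : porcupine L} (hs : (s : Coord L) ∈ (porcupine L).extremePoints ℝ) :
    ∃ l, s = tipPos l ∨ s = tipNeg l := by
  obtain ⟨l, c, hc, rfl⟩ := exists_eq_hair hs
  obtain ⟨h1, h2⟩ := abs_le.1 hc
  refine ⟨l, ?_⟩
  rcases h1.eq_or_lt with rfl | h1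
  · exact Or.inr rfl
  rcases h2.eq_or_lt with rfl | h2
  · exact Or.inl rfl
  have h3 := hs.2 (tipPos l).2 (tipNeg l).2 ⟨(1 + c) / 2, (1 - c) / 2, by linarith, by linarith,
    by ring, by
      ext m
      · simp only [map_add, map_smul, tipPos, tipNeg, base_hair, smul_eq_mul]; ring
      · by_cases h : m = l
        · subst h
          simp only [map_add, map_smul, tipPos, tipNeg, quill_hair_self, smul_eq_mul]; ring
        · simp [tipPos, tipNeg, quill_hair_of_ne h]⟩
  exact Or.inl (Subtype.ext h3.symm)

end ExtremePoints

lemma isScattered_extremePoints_porcupine (L : Type u) [TopologicalSpace L] [CompactSpace L]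
    [T2Space L] [Nonempty L] : IsScattered ((porcupine L).extremePoints ℝ) := by
  rintro S hS ⟨s, hs⟩
  have key : ∀ x ∈ S, ∃ (l : L) (c : ℝ) (hc : |c| ≤ 1), (c = 1 ∨ c = -1) ∧
      x = (hair l c hc : Coord L) := fun x hx => by
    obtain ⟨l, h | h⟩ := exists_eq_tip (s := ⟨x, (hS hx).1⟩) (hS hx)
    · exact ⟨l, 1, _, Or.inl rfl, congrArg Subtype.val h⟩
    · exact ⟨l, -1, _, Or.inr rfl, congrArg Subtype.val h⟩
  obtain ⟨l, c, hc, hc1, rfl⟩ := key s hs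
  -- This open set contains no tip other than the given one, so the extreme points are even
  -- relatively discrete.
  refine ⟨_, hs, {x | 0 < c * Coord.quill l x}, isOpen_lt (by fun_prop) (by fun_prop), ?_⟩
  refine Set.Subset.antisymm ?_ ?_
  · rintro x ⟨hx, hxS⟩
    obtain ⟨m, d, hd, hd1, rfl⟩ := key x hxS
    change 0 < c * Coord.quill l _ at hx
    by_cases h : l = m
    · subst h
      rw [quill_hair_self] at hx
      have : d = c := by
        rcases hc1 with rfl | rfl <;> rcases hd1 with rfl | rfl <;> first | rfl | norm_num at hx
      subst this
      rfl
    · rw [quill_hair_of_ne h, mul_zero] at hx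
      exact absurd hx (lt_irrefl 0)
  · rintro _ rfl
    refine ⟨?_, hs⟩
    change 0 < c * Coord.quill l _
    rw [quill_hair_self]
    rcases hc1 with rfl | rfl <;> norm_num

/-! ### A diffuse state on a non-scattered space -/

section Diffuse

open Coord

variable {L : Type u} [TopologicalSpace L] [CompactSpace L] [T2Space L] [Nonempty L]

lemma exists_perfect_of_not_isScattered {X : Type*} [TopologicalSpace X]
    (h : ¬ IsScattered (Set.univ : Set X)) : ∃ C : Set X, Perfect C ∧ C.Nonempty := by
  simp only [IsScattered, not_forall] at h
  obtain ⟨S, -, hS, h⟩ := h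
  refine ⟨closure S, Preperfect.perfect_closure ?_, hS.closure⟩
  rw [preperfect_iff_nhds]
  intro x hx U hU
  obtain ⟨W, hWU, hW, hxW⟩ := mem_nhds_iff.1 hU
  by_contra! hne
  refine h ⟨x, hx, W, hW, Set.Subset.antisymm (fun y hy => hne y ⟨hWU hy.1, hy.2⟩) ?_⟩
  rintro _ rfl
  exact ⟨hxW, hx⟩

variable (L) in
/-- The nonempty perfect subsets of `L`. -/
def PerfectSet : Type u := {C : Set L // Perfect C ∧ C.Nonempty}

namespace PerfectSet

lemma exists_split (C : PerfectSet L) :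
    ∃ D : Bool → PerfectSet L, (∀ b, (D b).1 ⊆ C.1) ∧ Disjoint (D false).1 (D true).1 := by
  obtain ⟨C₀, C₁, h0, h1, h⟩ := C.2.1.splitting C.2.2
  exact ⟨fun b => cond b ⟨C₁, h1.1, h1.2.1⟩ ⟨C₀, h0.1, h0.2.1⟩,
    Bool.forall_bool.2 ⟨h0.2.2, h1.2.2⟩, h⟩

/-- Disjoint nonempty perfect subsets of a perfect set. -/
def split (C : PerfectSet L) : Bool → PerfectSet L := C.exists_split.choose

lemma split_subset (C : PerfectSet L) (b : Bool) : (C.split b).1 ⊆ C.1 :=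
  C.exists_split.choose_spec.1 b

lemma disjoint_split (C : PerfectSet L) : Disjoint (C.split false).1 (C.split true).1 :=
  C.exists_split.choose_spec.2

/-- The average of point evaluations at points of the `2 ^ n` perfect sets obtained from `C` by `n`
iterations of `split`. -/
def average : ℕ → PerfectSet L → porcupine L
  | 0, C => body L C.2.2.some
  | n + 1, C => ⟨(1 / 2 : ℝ) • (average n (C.split false) : Coord L) +
      (1 / 2 : ℝ) • (average n (C.split true) : Coord L),
    convex_porcupine (average n (C.split false)).2 (average n (C.split true)).2 (by norm_num)
      (by norm_num) (by norm_num)⟩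

lemma state_average_succ (n : ℕ) (C : PerfectSet L) (b : Bool) (g : C(L, ℝ)) :
    state (average (n + 1) C) g =
      1 / 2 * state (average n (C.split b)) g + 1 / 2 * state (average n (C.split !b)) g := by
  have h : state (average (n + 1) C) g = 1 / 2 * state (average n (C.split false)) g +
      1 / 2 * state (average n (C.split true)) g := by
    simp only [state_apply, average, map_add, map_smul, smul_eq_mul]
  cases b
  · exact h
  · rw [h, add_comm, Bool.not_true]

lemma state_average_eq_zero (n : ℕ) (C : PerfectSet L) {g : C(L, ℝ)} (hg : ∀ x ∈ C.1, g x = 0) :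
    state (average n C) g = 0 := by
  induction n generalizing C with
  | zero => exact hg _ C.2.2.some_mem
  | succ n ih =>
    rw [state_average_succ n C false, ih _ fun x hx => hg x (C.split_subset _ hx),
      ih _ fun x hx => hg x (C.split_subset _ hx)]
    simp

/-- At each splitting `l` misses one of the two halves. A Urysohn function that is 1 at `l` and 0 on
that half discards half of the average, so `n` splittings leave at most `(1 / 2) ^ n`. The bound is
uniform in `m ≥ n`, so it survives passage to a limit. -/
lemma exists_state_average_le (n : ℕ) (C : PerfectSet L) (l : L) :
    ∃ g : C(L, ℝ), 0 ≤ g ∧ g ≤ 1 ∧ g l = 1 ∧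
      ∀ m ≥ n, state (average m C) g ≤ (1 / 2 : ℝ) ^ n := by
  induction n generalizing C with
  | zero => exact ⟨1, zero_le_one, le_rfl, rfl, fun m _ => by rw [state_one, pow_zero]⟩
  | succ n ih =>
    obtain ⟨b, hb⟩ : ∃ b, l ∉ (C.split b).1 := by
      by_contra! h
      exact Set.disjoint_left.1 C.disjoint_split (h false) (h true)
    obtain ⟨g, hg0, hg1, hgl, hg⟩ := ih (C.split !b)
    obtain ⟨k, hk0, hk1, hk⟩ := exists_continuous_zero_one_of_isClosed (s := (C.split b).1)
      (t := {l}) (C.split b).2.1.closed isClosed_singleton (by simpa using hb)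
    have hkl : k l = 1 := hk1 rfl
    have hkg : k * g ≤ g := fun x => mul_le_of_le_one_left (hg0 x) (hk x).2
    refine ⟨k * g, fun x => mul_nonneg (hk x).1 (hg0 x), hkg.trans hg1, by simp [hkl, hgl], ?_⟩
    intro m hm
    obtain ⟨m, rfl⟩ : ∃ m', m = m' + 1 := ⟨m - 1, by omega⟩
    rw [state_average_succ m C b, state_average_eq_zero m _ fun x hx => by
      rw [ContinuousMap.mul_apply, hk0 hx, Pi.zero_apply, zero_mul]]
    have := (state_mono (average m (C.split !b)) hkg).trans (hg m (by omega))
    rw [pow_succ]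
    linarith

end PerfectSet

/-- If `L` is not scattered, then some state of `C(L, ℝ)` has no point masses. -/
lemma exists_diffuse (hL : ¬ IsScattered (Set.univ : Set L)) :
    ∃ t : porcupine L, ∀ (l : L) (ε : ℝ), 0 < ε →
      ∃ g : C(L, ℝ), 0 ≤ g ∧ g l = 1 ∧ state t g ≤ ε := by
  obtain ⟨C, hC⟩ := exists_perfect_of_not_isScattered hL
  let a : ℕ → porcupine L := fun n => PerfectSet.average n ⟨C, hC⟩
  let U : Ultrafilter (porcupine L) := (Filter.hyperfilter ℕ).map a
  refine ⟨U.lim, fun l ε hε => ?_⟩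
  obtain ⟨n, hn⟩ := exists_pow_lt_of_lt_one hε (by norm_num : (1 / 2 : ℝ) < 1)
  obtain ⟨g, hg0, -, hgl, hg⟩ := PerfectSet.exists_state_average_le n ⟨C, hC⟩ l
  refine ⟨g, hg0, hgl, ?_⟩
  have h1 : Filter.Tendsto a (Filter.hyperfilter ℕ) (𝓝 U.lim) := U.le_nhds_lim
  have h2 := ((restrictDual (base g)).continuous.tendsto U.lim).comp h1
  refine le_of_tendsto h2 ?_
  filter_upwards [Nat.hyperfilter_le_atTop (Filter.eventually_ge_atTop n)] with m hm
  exact (hg m hm).trans hn.le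

variable [MeasurableSpace L] [BorelSpace L]

/-- If the state of `t` has no point masses, then neither does the maximal measure of `t`. -/
lemma boundaryMeasure_singleton {t : porcupine L} (ht : ∀ (l : L) (ε : ℝ), 0 < ε →
    ∃ g : C(L, ℝ), 0 ≤ g ∧ g l = 1 ∧ state t g ≤ ε) (x : porcupine L) :
    boundaryMeasure t {x} = 0 := by
  have hmass : ∀ l, mass t l = 0 := fun l => by
    refine le_antisymm (le_of_forall_pos_le_add fun ε hε => ?_) (mass_nonneg t l)
    obtain ⟨g, hg0, hgl, hg⟩ := ht l ε hε
    have := mass_mul_le t l hg0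
    rw [hgl, mul_one] at this
    linarith
  -- Without atoms all hair terms vanish, and the maximal measure is the image of the state measure
  -- on the body.
  have hint : ∀ f : C(porcupine L, ℝ),
      ∫ s, f s ∂boundaryMeasure t = state t (f.comp (body L)) := fun f => by
    have : hairTerm t f = 0 := by
      funext l
      have h := abs_quill_le_mass t l
      rw [hmass, abs_nonpos_iff] at h
      simp [hairTerm, hmass, h]
    rw [integral_boundaryMeasure, boundaryFunctional_apply, this]
    simp
  refine measure_singleton_eq_zero_of_integral_le _ x fun ε hε => ?_
  by_cases hx : x ∈ Set.range (body L)
  · obtain ⟨l, rfl⟩ := hx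
    obtain ⟨g, hg0, hgl, hg⟩ := ht l ε hε
    refine ⟨restrictDual (base g), fun s => state_nonneg s hg0, hgl, ?_⟩
    rw [hint]
    exact hg
  · obtain ⟨g, hg0, hg1, hg⟩ := exists_continuous_zero_one_of_isClosed (t := {x})
      (isCompact_range (body L).continuous).isClosed isClosed_singleton (by simpa using hx)
    refine ⟨g, fun y => (hg y).1, hg1 rfl, ?_⟩
    have : g.comp (body L) = 0 := ContinuousMap.ext fun l => hg0 (Set.mem_range_self l)
    rw [hint, this, map_zero]
    exact hε.le

end Diffuse

/-! ### Positive measures as dual-valued measures -/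

section ScalarDual

variable {X : Type*} [MeasurableSpace X]

/-- A finite positive measure as a vector measure with values in the dual of `ℝ`. -/
def toDualMeasure (μ : Measure X) [IsFiniteMeasure μ] : VectorMeasure X (StrongDual ℝ ℝ) :=
  μ.toSignedMeasure.mapRange
    (ContinuousLinearMap.toSpanSingleton ℝ (ContinuousLinearMap.id ℝ ℝ)).toAddMonoidHom
    (ContinuousLinearMap.toSpanSingleton ℝ (ContinuousLinearMap.id ℝ ℝ)).continuous

lemma toDualMeasure_apply (μ : Measure X) [IsFiniteMeasure μ] {B : Set X} (hB : MeasurableSet B)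
    (x : ℝ) : toDualMeasure μ B x = μ.real B * x := by
  simp [toDualMeasure, VectorMeasure.mapRange_apply, Measure.toSignedMeasure_apply_measurable hB]

lemma enorm_toDualMeasure (μ : Measure X) [IsFiniteMeasure μ] {B : Set X} (hB : MeasurableSet B) :
    ‖toDualMeasure μ B‖ₑ = μ B := by
  have : toDualMeasure μ B = μ.real B • ContinuousLinearMap.id ℝ ℝ := by
    ext
    simp [toDualMeasure_apply μ hB]
  rw [this, enorm_smul, ← ofReal_norm (ContinuousLinearMap.id ℝ ℝ), ContinuousLinearMap.norm_id,
    Real.enorm_of_nonneg measureReal_nonneg]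
  simp [Measure.real]

lemma variation_toDualMeasure (μ : Measure X) [IsFiniteMeasure μ] :
    (toDualMeasure μ).variation = μ :=
  le_antisymm (VectorMeasure.variation_le_of_forall_enorm_le fun _ hB =>
      (enorm_toDualMeasure μ hB).le)
    (Measure.le_iff.2 fun B hB => (enorm_toDualMeasure μ hB).symm.le.trans
      (VectorMeasure.enorm_measure_le_variation _ B))

lemma enorm_dual_real (φ : StrongDual ℝ ℝ) : ‖φ‖ₑ = ‖φ 1‖ₑ := by
  have : φ = φ 1 • ContinuousLinearMap.id ℝ ℝ := by
    ext
    simp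
  conv_lhs => rw [this]
  rw [enorm_smul, ← ofReal_norm (ContinuousLinearMap.id ℝ ℝ), ContinuousLinearMap.norm_id]
  simp

end ScalarDual

/-! ### Representing measures of evaluation functionals -/

section DirectRepresentation

variable {V : Type*} [AddCommGroup V] [Module ℝ V] [TopologicalSpace V]
  [MeasurableSpace V] [BorelSpace V] {K : Set V}

/-- Both integrals extend the same set function from simple functions, relative to the same measure.
-/
lemma dualIntegral_toDualMeasure (μ : Measure K) [IsFiniteMeasure μ] (f : K → ℝ) :
    dualIntegral f (toDualMeasure μ) = ∫ t, f t ∂μ := by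
  rw [dualIntegral, VectorMeasure.integral_eq_setToFun, MeasureTheory.integral_eq_setToFun]
  simp only [variation_toDualMeasure]
  refine setToFun_congr_left' _ _ (fun s hs _ => ?_) _
  refine ContinuousLinearMap.ext fun x => ?_
  change toDualMeasure μ s x = weightedSMul μ s x
  rw [toDualMeasure_apply μ hs, weightedSMul_apply, smul_eq_mul]

lemma isBoundaryVectorMeasure_smul_toDualMeasure {N : Measure K} (hN : IsMaximalProb N)
    [IsFiniteMeasure N] (c : ℝ) : IsBoundaryVectorMeasure (c • toDualMeasure N) := by
  have := hN.1.1
  have := hN.1.2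
  rw [IsBoundaryVectorMeasure, VectorMeasure.variation_smul, variation_toDualMeasure]
  refine ⟨⟨inferInstance, inferInstance⟩, ?_⟩
  rcases eq_or_ne c 0 with rfl | hc
  · left
    simp
  · right
    have hc' : (‖c‖₊ : ℝ≥0∞) ≠ 0 := by simpa using hc
    have : ((‖c‖₊ • N) Set.univ)⁻¹ • ‖c‖₊ • N = N := by
      rw [Measure.smul_apply, measure_univ, ENNReal.smul_def, ENNReal.smul_def, smul_eq_mul, mul_one,
        smul_smul, ENNReal.inv_mul_cancel hc' ENNReal.coe_ne_top, one_smul]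
    rwa [this]

lemma countable_measure_zero_of_isDiscrete [T1Space V] {m : Measure K} (hm : IsDiscrete m) :
    ∃ C : Set K, C.Countable ∧ MeasurableSet C ∧ m Cᶜ = 0 := by
  obtain ⟨t, a, -, rfl⟩ := hm
  have hC : (Set.range t).Countable := Set.countable_range t
  refine ⟨Set.range t, hC, hC.measurableSet, ?_⟩
  rw [Measure.sum_apply _ hC.measurableSet.compl]
  simp [Measure.dirac_apply' _ hC.measurableSet.compl]

variable {E F : Type*} [NormedAddCommGroup E] [NormedSpace ℝ E]
  [NormedAddCommGroup F] [NormedSpace ℝ F]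

lemma enorm_sum_le_semivariation (G : Set K → (E →L[ℝ] StrongDual ℝ (StrongDual ℝ F)))
    {B : Set K} {ι : Type*} (S : Finset ι) (D : ι → Set K) (x : ι → E)
    (hD : ∀ i ∈ S, MeasurableSet (D i) ∧ D i ⊆ B)
    (hdisj : (S : Set ι).PairwiseDisjoint D) (hx : ∀ i ∈ S, ‖x i‖ ≤ 1) :
    ‖∑ i ∈ S, G (D i) (x i)‖ₑ ≤ semivariation G B := by
  have e := S.equivFin.symm
  have hsum : ∑ i ∈ S, G (D i) (x i) = ∑ i, G (D (e i)) (x (e i)) := by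
    rw [← Finset.sum_coe_sort]
    exact (e.sum_comp fun i : S => G (D i) (x i)).symm
  rw [hsum]
  refine le_iSup_of_le S.card (le_iSup_of_le (fun i => D (e i)) (le_iSup_of_le (fun i => x (e i))
    (le_iSup_of_le (fun i => hD _ (e i).2) (le_iSup_of_le (fun i j hij => ?_)
    (le_iSup_of_le (fun i => hx _ (e i).2) le_rfl)))))
  exact hdisj (e i).2 (e j).2 fun h => hij (e.injective (Subtype.ext h))

lemma enorm_apply_le_semivariation (G : Set K → (E →L[ℝ] StrongDual ℝ (StrongDual ℝ F)))
    {B : Set K} (hB : MeasurableSet B) {x : E} (hx : ‖x‖ ≤ 1) :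
    ‖G B x‖ₑ ≤ semivariation G B := by
  simpa using enorm_sum_le_semivariation G (Finset.univ : Finset Unit) (fun _ => B) (fun _ => x)
    (fun _ _ => ⟨hB, subset_rfl⟩) (by simp) fun _ _ => hx

variable [CompactSpace K]

/-- Evaluation of continuous affine functions at a point. -/
def evalAffine (t : K) : A K ℝ →L[ℝ] ℝ :=
  LinearMap.mkContinuous
    { toFun := fun f => (f : C(K, ℝ)) t
      map_add' := fun _ _ => rfl
      map_smul' := fun _ _ => rfl } 1
    fun f => by
      rw [one_mul]
      exact (f : C(K, ℝ)).norm_coe_le_norm t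

/-- The constant function `1` as a continuous affine function. -/
def oneAffine (K : Set V) : A K ℝ := ⟨1, fun _ _ _ a b _ _ hab _ => by simp [hab]⟩

lemma enorm_evalAffine (t : K) : ‖evalAffine t‖ₑ = 1 := by
  have h1 : ‖evalAffine t‖ ≤ 1 := LinearMap.mkContinuous_norm_le _ zero_le_one _
  have h2 : ‖oneAffine K‖ ≤ 1 := (ContinuousMap.norm_le _ zero_le_one).2 fun x => by
    simp [oneAffine]
  have h3 := (evalAffine t).le_of_opNorm_le_of_le le_rfl h2
  have h4 : evalAffine t (oneAffine K) = 1 := rfl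
  rw [h4, norm_one, mul_one] at h3
  rw [← ofReal_norm, le_antisymm h1 h3, ENNReal.ofReal_one]

/-- A maximal measure representing `t` gives a representing measure of the evaluation at `t`. -/
lemma exists_isRepresentingMeasure_evalAffine {N : Measure K} (hN : IsMaximalProb N) {t : K}
    (hNt : Represents N t) :
    ∃ G : Set K → (ℝ →L[ℝ] StrongDual ℝ (StrongDual ℝ ℝ)),
      IsRepresentingMeasure (evalAffine t) G := by
  have := hN.1.1
  let I := NormedSpace.inclusionInDoubleDual ℝ ℝ
  have hI : ∀ (c : ℝ) (x : ℝ) (y : StrongDual ℝ ℝ), (c • I) x y = c * y x := fun c x y => by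
    simp [I]
  -- A functional `y` on `ℝ` is multiplication by `y 1`, so the associated scalar measures are `y 1
  -- • N`.
  let G : Set K → (ℝ →L[ℝ] StrongDual ℝ (StrongDual ℝ ℝ)) := fun B => N.real B • I
  have hsemi : semivariation G Set.univ = 1 := by
    refine le_antisymm ?_ ?_
    · refine iSup_le fun n => iSup_le fun D => iSup_le fun x => iSup_le fun hD => iSup_le fun hdisj =>
        iSup_le fun hx => ?_
      calc ‖∑ i, G (D i) (x i)‖ₑ ≤ ∑ i, ‖G (D i) (x i)‖ₑ := enorm_sum_le _ _
        _ ≤ ∑ i, N (D i) := Finset.sum_le_sum fun i _ => by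
          have h1 : ‖I (x i)‖ₑ ≤ 1 := by
            rw [← ofReal_norm, ← ENNReal.ofReal_one]
            exact ENNReal.ofReal_le_ofReal
              ((NormedSpace.double_dual_bound ℝ ℝ (x i)).trans (hx i))
          have h2 : G (D i) (x i) = N.real (D i) • I (x i) := rfl
          rw [h2, enorm_smul, Real.enorm_of_nonneg measureReal_nonneg, ofReal_measureReal]
          exact mul_le_of_le_one_right' h1
        _ = N (⋃ i, D i) := by
          rw [measure_iUnion (fun i j hij => hdisj i j hij) fun i => (hD i).1, tsum_fintype]
        _ ≤ 1 := prob_le_one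
    · have h1 := enorm_apply_le_semivariation G MeasurableSet.univ (x := (1 : ℝ)) (by simp)
      refine le_trans ?_ h1
      have h2 : ‖G Set.univ 1 (ContinuousLinearMap.id ℝ ℝ)‖ₑ ≤
          ‖G Set.univ 1‖ₑ * ‖ContinuousLinearMap.id ℝ ℝ‖ₑ := ContinuousLinearMap.le_opENorm _ _
      rw [← ofReal_norm (ContinuousLinearMap.id ℝ ℝ), ContinuousLinearMap.norm_id,
        ENNReal.ofReal_one, mul_one, hI] at h2
      simpa using h2
  have hint : ∀ (y : StrongDual ℝ ℝ) (f : A K ℝ),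
      dualIntegral (f : C(K, ℝ)) (y 1 • toDualMeasure N) = y ((f : C(K, ℝ)) t) := fun y f => by
    rw [dualIntegral, VectorMeasure.integral_smul_vectorMeasure]
    have h1 := dualIntegral_toDualMeasure N (f : C(K, ℝ))
    rw [dualIntegral] at h1
    rw [h1, hNt _ f.2, smul_eq_mul, mul_comm, ← smul_eq_mul, ← map_smul, smul_eq_mul, mul_one]
  refine ⟨G, fun B C hB hC hBC => ?_, ⟨fun y => y 1 • toDualMeasure N, fun y B hB x => ?_,
    fun y => isBoundaryVectorMeasure_smul_toDualMeasure hN _, fun f => ?_, fun y f => ?_⟩, ?_, ?_⟩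
  · simp only [G]
    rw [measureReal_union hBC hC, add_smul]
  · rw [hI, smul_apply, smul_apply, toDualMeasure_apply N hB]
    have : y x = x * y 1 := by rw [← smul_eq_mul, ← map_smul, smul_eq_mul, mul_one]
    rw [this, smul_eq_mul]
    ring
  · simp only [hint]
    exact WeakDual.eval_continuous _
  · rw [hint]
    rfl
  · rw [hsemi]
    exact ENNReal.one_ne_top
  · rw [hsemi, enorm_evalAffine]

end DirectRepresentation

/-! ### Atomless maximal measures exclude discrete control -/

section NoDiscreteControl

variable {V : Type*} [AddCommGroup V] [Module ℝ V] [TopologicalSpace V] [T2Space V]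
  [MeasurableSpace V] [BorelSpace V] {K : Set V} [CompactSpace K]

/-- A scalar measure whose total value attains its variation has no cancellation: `μ ≤ |μ|` on `B`
and on `Bᶜ`, with equality of the sums. -/
lemma eq_toDualMeasure {μ : VectorMeasure K (StrongDual ℝ ℝ)} [IsFiniteMeasure μ.variation]
    (hle : μ.variation Set.univ ≤ 1) (h1 : μ Set.univ 1 = 1) :
    IsProbabilityMeasure μ.variation ∧ μ = toDualMeasure μ.variation := by
  have hb : ∀ B, μ B 1 ≤ μ.variation.real B := fun B => by
    have h2 := VectorMeasure.norm_measure_le_variation (μ := μ) (E := B)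
    have h3 := (μ B).le_of_opNorm_le h2 1
    rw [norm_one, mul_one] at h3
    exact (le_abs_self _).trans h3
  have hprob : IsProbabilityMeasure μ.variation := by
    refine ⟨le_antisymm hle ?_⟩
    have := hb Set.univ
    rw [h1, measureReal_def, ← ENNReal.toReal_one] at this
    exact (ENNReal.toReal_le_toReal ENNReal.one_ne_top (measure_ne_top _ _)).1 this
  refine ⟨hprob, ?_⟩
  ext B hB
  rw [toDualMeasure_apply _ hB, mul_one]
  refine le_antisymm (hb B) ?_
  have h2 : μ Set.univ = μ B + μ Bᶜ := by
    rw [← VectorMeasure.of_union disjoint_compl_right hB hB.compl, Set.union_compl_self]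
  rw [h2, add_apply] at h1
  have h3 := hb Bᶜ
  rw [probReal_compl_eq_one_sub hB] at h3
  linarith

/-- If the only maximal measure representing `t` has no atoms, then no representing measure of the
evaluation at `t` has a discrete control measure. -/
lemma not_exists_isDiscrete_isControlMeasure {N : Measure K} {t : K}
    (huniq : ∀ μ, IsMaximalProb μ ∧ Represents μ t → μ = N) (hN : ∀ x, N {x} = 0)
    {G : Set K → (ℝ →L[ℝ] StrongDual ℝ (StrongDual ℝ ℝ))}
    (hG : IsRepresentingMeasure (evalAffine t) G) :
    ¬ ∃ m : Measure K, IsDiscrete m ∧ IsControlMeasure m G := by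
  rintro ⟨m, hm, -, hctrl⟩
  obtain ⟨-, ⟨Gy, hGy, hbd, -, hrep⟩, -, hnorm⟩ := hG
  rw [enorm_evalAffine] at hnorm
  let y : StrongDual ℝ ℝ := ContinuousLinearMap.id ℝ ℝ
  have hy : ‖y‖ₑ = 1 := by
    rw [← ofReal_norm, ContinuousLinearMap.norm_id, ENNReal.ofReal_one]
  obtain ⟨⟨hfin, -⟩, hbdy⟩ := hbd y
  -- Signs `x p` turn the variation sums into sums admitted in the semivariation, which has total
  -- value `‖T‖ = 1`.
  have hle : (Gy y).variation Set.univ ≤ 1 := by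
    refine le_of_forall_lt fun a ha => ?_
    obtain ⟨P, -, hPd, hPm, hP⟩ := VectorMeasure.exists_lt_sum_of_lt_variation _ MeasurableSet.univ ha
    refine hP.trans_le ?_
    let x : Set K → ℝ := fun p => SignType.sign (Gy y p 1)
    have hval : ∀ p ∈ P, G p (x p) y = |Gy y p 1| := fun p hp => by
      rw [← hGy y p (hPm p hp), ← mul_one (x p), ← smul_eq_mul, map_smul, smul_eq_mul,
        sign_mul_self]
    have h1 : ∑ p ∈ P, ‖Gy y p‖ₑ = ENNReal.ofReal ((∑ p ∈ P, G p (x p)) y) := by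
      rw [sum_apply, Finset.sum_congr rfl hval, ENNReal.ofReal_sum_of_nonneg fun _ _ => abs_nonneg _]
      exact Finset.sum_congr rfl fun p _ => by
        rw [enorm_dual_real, ← ofReal_norm, Real.norm_eq_abs]
    rw [h1]
    calc ENNReal.ofReal ((∑ p ∈ P, G p (x p)) y) ≤ ‖(∑ p ∈ P, G p (x p)) y‖ₑ :=
          Real.ofReal_le_enorm _
      _ ≤ ‖∑ p ∈ P, G p (x p)‖ₑ * ‖y‖ₑ := ContinuousLinearMap.le_opENorm _ _
      _ ≤ semivariation G Set.univ := by
        rw [hy, mul_one]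
        refine enorm_sum_le_semivariation G P id x (fun p hp => ⟨hPm p hp, Set.subset_univ _⟩) hPd
          fun p _ => ?_
        rcases lt_trichotomy (Gy y p 1) 0 with h | h | h <;> simp [x, h]
      _ = 1 := hnorm.symm
  -- Testing on the constant function 1 shows that the variation bound is attained.
  have h1 : Gy y Set.univ 1 = 1 := by
    have h2 := hrep y (oneAffine K)
    have h3 : dualIntegral (oneAffine K : C(K, ℝ)) (Gy y) = Gy y Set.univ 1 :=
      VectorMeasure.integral_const (1 : ℝ)
    rw [← h3, ← h2]
    rfl
  obtain ⟨hprob, heq⟩ := eq_toDualMeasure hle h1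
  have hmax : IsMaximalProb (Gy y).variation := by
    rcases hbdy with h | h
    · have h2 : (Gy y).variation Set.univ = 1 := measure_univ
      rw [h] at h2
      simp at h2
    · rwa [measure_univ, inv_one, one_smul] at h
  have hvar : (Gy y).variation = N := huniq _ ⟨hmax, fun a ha => by
    rw [← dualIntegral_toDualMeasure, ← heq, ← hrep y ⟨a, ha⟩]
    rfl⟩
  obtain ⟨C, hC, hCm, hmC⟩ := countable_measure_zero_of_isDiscrete hm
  -- The control measure is zero on `Cᶜ`, so the semivariation there is below every positive `ε`; a
  -- nonzero value would be less than itself.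
  have hsemi : semivariation G Cᶜ = 0 := by
    by_contra hne
    obtain ⟨δ, hδ, h⟩ := hctrl _ (pos_iff_ne_zero.2 hne)
    exact (h Cᶜ hCm.compl (hmC ▸ hδ)).false
  have hG0 : G Cᶜ 1 = 0 := by
    rw [← enorm_eq_zero, ← nonpos_iff_eq_zero, ← hsemi]
    exact enorm_apply_le_semivariation G hCm.compl (by simp)
  have h2 : (Gy y).variation.real Cᶜ = 0 := by
    have h3 := hGy y Cᶜ hCm.compl 1
    rw [hG0, heq, toDualMeasure_apply _ hCm.compl, mul_one] at h3
    exact h3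
  have h3 : (Gy y).variation C = 0 := by
    rw [hvar]
    exact (measure_null_iff_singleton hC).2 fun x _ => hN x
  rw [probReal_compl_eq_one_sub hCm, measureReal_def, h3] at h2
  simp at h2

end NoDiscreteControl

end ChoquetTheory

end

theorem mainTheorem12 (L : Type u) [TopologicalSpace L] [CompactSpace L] [T2Space L]
    (hL : ¬ ChoquetTheory.IsScattered (Set.univ : Set L)) :
    ∃ (V : Type u) (_ : AddCommGroup V) (_ : Module ℝ V) (_ : TopologicalSpace V)
      (_ : IsTopologicalAddGroup V) (_ : ContinuousSMul ℝ V) (_ : LocallyConvexSpace ℝ V)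
      (_ : T2Space V) (_ : MeasurableSpace V) (_ : BorelSpace V)
      (K : Set V) (_ : CompactSpace K),
      K.Nonempty ∧ Convex ℝ K ∧ ChoquetTheory.IsSimplex K ∧
      ChoquetTheory.IsScattered (K.extremePoints ℝ) ∧
      (∃ T : ChoquetTheory.A K ℝ →L[ℝ] ℝ,
        (∃ G, ChoquetTheory.IsRepresentingMeasure T G) ∧
        ∀ G, ChoquetTheory.IsRepresentingMeasure T G →
          ¬ ∃ m : MeasureTheory.Measure K,
            ChoquetTheory.IsDiscrete m ∧ ChoquetTheory.IsControlMeasure m G) ∧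
      ∀ (E : Type v) [NormedAddCommGroup E] [NormedSpace ℝ E] [CompleteSpace E],
        ChoquetTheory.IsOneComplementedIn C(L, E) (ChoquetTheory.A K E) := by
  -- The empty space is scattered.
  have hne : Nonempty L := by
    by_contra h
    rw [not_nonempty_iff] at h
    exact hL fun _ _ ⟨x, _⟩ => isEmptyElim x
  let _ : MeasurableSpace L := borel L
  have _ : BorelSpace L := ⟨rfl⟩
  obtain ⟨t, ht⟩ := ChoquetTheory.exists_diffuse hL
  obtain ⟨⟨hmax, hrep⟩, huniq⟩ := ChoquetTheory.isMaximalProb_boundaryMeasure t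
  refine ⟨ChoquetTheory.Coord L, inferInstance, inferInstance, inferInstance, inferInstance,
    inferInstance, inferInstance, inferInstance, inferInstance, inferInstance,
    ChoquetTheory.porcupine L, inferInstance, ⟨t, t.2⟩, ChoquetTheory.convex_porcupine,
    ChoquetTheory.isSimplex_porcupine L, ChoquetTheory.isScattered_extremePoints_porcupine L,
    ⟨ChoquetTheory.evalAffine t,
      ChoquetTheory.exists_isRepresentingMeasure_evalAffine hmax hrep, fun G hG =>
        ChoquetTheory.not_exists_isDiscrete_isControlMeasure huniq
          (ChoquetTheory.boundaryMeasure_singleton ht) hG⟩,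
    fun E _ _ _ => ChoquetTheory.isOneComplementedIn_porcupine L E⟩
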